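/- Let $r>0$, and let $\epsilon\in\{1,i\}$. Put $\langle X,Y\rangle = X_1Y_1+X_2Y_2+X_3Y_3+\epsilon^2X_4Y_4$ on $\mathbb R^4$. For $\epsilon=1$ let $\Sigma=S^3_r=\{X:\langle X,X\rangle=r^2\}$, and for $\epsilon=i$ let $\Sigma=H^3_r=\{X:\langle X,X\rangle=-r^2,\ X_4>0\}$, each with the Riemannian metric induced by $\langle\cdot,\cdot\rangle$ (so that $\Sigma$ has constant scalar curvature $R=6/(\epsilon^2r^2)$). Let $a>0$, and in the spherical case let $a<a_{\max}=2r\arctan\sqrt2$. A regular geodesic tetrahedron with edge $a$ is the geodesic convex hull $T\subset\Sigma$ of four points of $\Sigma$ any two of which are joined by a geodesic arc, the central projection of the straight segment between them, of length $a$. Let $U=\{X\in\Sigma: X_4>0\}$, with Klein coordinates $x(X)=\frac{r}{X_4}(X_1,X_2,X_3)$. Every regular geodesic tetrahedron $T\subset\Sigma$ with edge $a$, in any position, has finite Riemannian volume $$V=12\,\epsilon^3r^3\int_0^{\tan\left(\frac{a}{2\epsilon r}\right)}\frac{t\,\arctan t}{(3-t^2)\sqrt{2-t^2}}\,dt,$$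 the integral being taken along the straight segment in $\mathbb C$. Explicitly, in the spherical case $\epsilon=1$, $$V=12\,r^3\int_0^{\tan\left(\frac{a}{2r}\right)}\frac{t\,\arctan t}{(3-t^2)\sqrt{2-t^2}}\,dt,$$ and in the hyperbolic case $\epsilon=i$, $$V=12\,r^3\int_0^{\tanh\left(\frac{a}{2r}\right)}\frac{t\,\operatorname{artanh} t}{(3+t^2)\sqrt{2+t^2}}\,dt.$$ If moreover $T\subset U$, then $$V=\int_{x(T)}\frac{r^4}{(\epsilon^2r^2+|x|^2)^2}\,dx .$$ Finally, there is such a tetrahedron $T\subset U$ whose image $x(T)$ is the Euclidean regular tetrahedron centred at the origin with edge $$a_0=\frac{2\epsilon r\tan\left(\frac{a}{2\epsilon r}\right)}{\sqrt{1-\frac12\tan^2\left(\frac{a}{2\epsilon r}\right)}},$$ namely the one with vertices $\left(\pm\frac{a_0}{2},-\frac{\sqrt3a_0}{6},-\frac{\sqrt6a_0}{12}\right)$, $\left(0,\frac{\sqrt3a_0}{3},-\frac{\sqrt6a_0}{12}\right)$, $\left(0,0,\frac{\sqrt6a_0}{4}\right)$. -/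

import Mathlib

open scoped ENNReal
open MeasureTheory

noncomputable section

/-- The two types of model spaces of constant nonzero curvature: the 3-sphere `S³_r` in Euclidean
4-space, and hyperbolic 3-space `H³_r` (upper sheet of the hyperboloid) in Minkowski 4-space. -/
inductive ModelSpace where
  | sphere : ModelSpace
  | hyperbolic : ModelSpace

namespace ModelSpace

/-- The compact symbol `ε`: it is `1` for the sphere and `i` for hyperbolic space. -/
def eps : ModelSpace → ℂ
  | sphere => 1
  | hyperbolic => Complex.I

/-- The real number `ε²`. -/
def epsSq : ModelSpace → ℝ
  | sphere => 1
  | hyperbolic => -1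

/-- The ambient flat metric `dx₁² + dx₂² + dx₃² + ε² dx₄²` on `ℝ⁴`. -/
def form (m : ModelSpace) (X Y : Fin 4 → ℝ) : ℝ :=
  X 0 * Y 0 + X 1 * Y 1 + X 2 * Y 2 + m.epsSq * (X 3 * Y 3)

/-- The space `S³_r` or `H³_r`: the hypersurface `⟨X, X⟩ = ε² r²`, where in the hyperbolic case
only the top sheet is kept. -/
def space (m : ModelSpace) (r : ℝ) : Set (Fin 4 → ℝ) :=
  {X | m.form X X = m.epsSq * r ^ 2 ∧ (m = hyperbolic → 0 < X 3)}

/-- Radial (central) projection to the hypersurface `⟨X, X⟩ = ε² r²`; meaningful where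
`0 < ε² ⟨X, X⟩`. -/
def radial (m : ModelSpace) (r : ℝ) (X : Fin 4 → ℝ) : Fin 4 → ℝ :=
  (r / √(m.epsSq * m.form X X)) • X

/-- The geodesic arc from `P` to `Q`: the central projection of the straight segment. It lies in
the plane through the centre spanned by `P` and `Q`. -/
def geodesicArc (m : ModelSpace) (r : ℝ) (P Q : Fin 4 → ℝ) (t : ℝ) : Fin 4 → ℝ :=
  m.radial r ((1 - t) • P + t • Q)

/-- The length of the geodesic arc from `P` to `Q` in the induced Riemannian metric. -/
def arcLength (m : ModelSpace) (r : ℝ) (P Q : Fin 4 → ℝ) : ℝ :=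
  ∫ t in (0 : ℝ)..1,
    √(m.form (deriv (m.geodesicArc r P Q) t) (deriv (m.geodesicArc r P Q) t))

/-- The geodesic tetrahedron with vertices `P 0, …, P 3`: the part of the space lying in the convex
cone spanned by the vertices, i.e. their geodesic convex hull. -/
def tetrahedron (m : ModelSpace) (r : ℝ) (P : Fin 4 → Fin 4 → ℝ) : Set (Fin 4 → ℝ) :=
  {X | X ∈ m.space r ∧ ∃ w : Fin 4 → ℝ, (∀ i, 0 ≤ w i) ∧ X = ∑ i, w i • P i}

/-- `P` lists the vertices of a regular geodesic tetrahedron with edge length `a`. -/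
def IsRegularTetrahedron (m : ModelSpace) (r a : ℝ) (P : Fin 4 → Fin 4 → ℝ) : Prop :=
  (∀ i, P i ∈ m.space r) ∧ ∀ i j, i ≠ j → m.arcLength r (P i) (P j) = a

/-- The open upper part `x₄ > 0` of the space, on which Klein coordinates are defined: the open
upper hemisphere of `S³_r`, or all of `H³_r`. -/
def upper (m : ModelSpace) (r : ℝ) : Set (Fin 4 → ℝ) :=
  {X | X ∈ m.space r ∧ 0 < X 3}

/-- Klein coordinates (central projection to the hyperplane `x₄ = r`). -/
def klein (r : ℝ) (X : Fin 4 → ℝ) : Fin 3 → ℝ :=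
  ![r * X 0 / X 3, r * X 1 / X 3, r * X 2 / X 3]

/-- The range of the Klein coordinates: `ℝ³` for the sphere, the open ball of radius `r` for
hyperbolic space. -/
def kleinDomain (m : ModelSpace) (r : ℝ) : Set (Fin 3 → ℝ) :=
  {x | 0 < r ^ 2 + m.epsSq * ∑ i, x i ^ 2}

/-- The inverse of the Klein coordinates on `upper` (`s = 1`), and its antipode (`s = -1`), which
for the sphere parametrizes the open lower hemisphere. -/
def kleinInv (m : ModelSpace) (r s : ℝ) (x : Fin 3 → ℝ) : Fin 4 → ℝ :=
  s • m.radial r ![x 0, x 1, x 2, r]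

/-- The matrix `g_{AB}(x)` of the induced Riemannian metric in Klein coordinates. -/
def metricMatrix (m : ModelSpace) (r s : ℝ) (x : Fin 3 → ℝ) : Matrix (Fin 3) (Fin 3) ℝ :=
  Matrix.of fun A B => m.form (fderiv ℝ (m.kleinInv r s) x (Pi.single A 1))
    (fderiv ℝ (m.kleinInv r s) x (Pi.single B 1))

/-- The volume of the part of `T` lying in the chart `kleinInv r s`: the integral of
`√|det g|` over the coordinate image. -/
def chartVolume (m : ModelSpace) (r s : ℝ) (T : Set (Fin 4 → ℝ)) : ℝ≥0∞ :=
  ∫⁻ x in {x | x ∈ m.kleinDomain r ∧ m.kleinInv r s x ∈ m.space r ∩ T},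
    ENNReal.ofReal (√|(m.metricMatrix r s x).det|)

/-- The Riemannian volume of a subset `T` of the space. The charts `s = 1` and `s = -1` have
disjoint images which cover `S³_r` up to the equator, a null set; for hyperbolic space the chart
`s = 1` is global and the term `s = -1` vanishes. -/
def riemannianVolume (m : ModelSpace) (r : ℝ) (T : Set (Fin 4 → ℝ)) : ℝ≥0∞ :=
  m.chartVolume r 1 T + m.chartVolume r (-1) T

/-- The edge length `2 ε r tan(a / (2 ε r)) / √(1 - tan²(a / (2 ε r)) / 2)` of the Klein image of a
regular geodesic tetrahedron with edge `a` centred at the origin of the coordinates. -/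
def kleinEdge : ModelSpace → ℝ → ℝ → ℝ
  | sphere, r, a => 2 * r * Real.tan (a / (2 * r)) / √(1 - Real.tan (a / (2 * r)) ^ 2 / 2)
  | hyperbolic, r, a => 2 * r * Real.tanh (a / (2 * r)) / √(1 + Real.tanh (a / (2 * r)) ^ 2 / 2)

end ModelSpace

/-- The Euclidean regular tetrahedron in `ℝ³` with edge `b`, centred at the origin. -/
def euclideanTetrahedron (b : ℝ) : Set (Fin 3 → ℝ) :=
  convexHull ℝ {![b / 2, -(√3 * b / 6), -(√6 * b / 12)], ![-(b / 2), -(√3 * b / 6), -(√6 * b / 12)],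
    ![0, √3 * b / 3, -(√6 * b / 12)], ![0, 0, √6 * b / 4]}

/-- The integral of `f` along the straight segment from `0` to `w` in `ℂ`. -/
def segmentIntegral (f : ℂ → ℂ) (w : ℂ) : ℂ :=
  ∫ s in (0 : ℝ)..1, w * f (s * w)

end

/-! Write η = ε² and T = tn(a/(2r)), where tn is tan or tanh. Both geometries are treated at once;
little more than η² = 1 distinguishes the signs.

An edge length a > 0 fixes the inner product of its end points as ηr²c with c = (1 - ηT²)/(1 + ηT²)
(`form_eq_of_arcLength`), so the vertices are equiangular. In Klein coordinates the volume density
is r⁴/(r² + η|x|²)² (`sqrt_det_metricMatrix`). Up to the factor 4/r, this is also the density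
obtained by slicing a solid cone in ℝ⁴ (`volume_cone_slice`). Hence V is 4/r times the Lebesgue
measure of the part η⟨X,X⟩ ≤ r² of the cone over the vertices. That is a linear problem: in the
basis of the vertices the region becomes {w ≥ 0, q_c(w) ≤ 1}, with q_c the normalized Gram form, and
the Gram matrix supplies the determinant. So V depends only on r, η and c, not on the position
(`IsEquiangular.riemannianVolume_eq`).

The region in w is invariant under permutations and consists of 24 copies of its sorted part, the
cone over the orthoscheme whose vertices are the barycentres of the tetrahedron, a face, an edge and
a vertex. In orthogonal coordinates adapted to this flag q_c is diagonal, and slicing once more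
leaves a triple integral of a rational function. With x = (q, qu, qus) the u-integral is elementary
(`lintegral_mul_inv_sq`). The substitution t = √2 T q/√(2 - ηT² + ηT²q²) then turns the q-integral
into one over [0, T], and the s-integral produces atn(t)/t (`ofReal_volumeIntegrand`), which gives
the stated integrand.

The bound a < a_max enters as 2 - ηT² > 0, equivalently 1 + 3c > 0, which makes q_c positive on the
nonzero nonnegative vectors. The complex formula is the real one after t is replaced by t/ε. -/

namespace ModelSpace

/-! ### Arc length and the inner product of the end points -/

lemma epsSq_mul_self (m : ModelSpace) : m.epsSq * m.epsSq = 1 := by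
  cases m <;> simp [epsSq]

lemma form_smul_add_smul (m : ModelSpace) (α β : ℝ) (A B : Fin 4 → ℝ) :
    m.form (α • A + β • B) (α • A + β • B) =
      α ^ 2 * m.form A A + 2 * α * β * m.form A B + β ^ 2 * m.form B B := by
  simp only [form, Pi.add_apply, Pi.smul_apply, smul_eq_mul]
  ring

lemma form_segment (m : ModelSpace) {r c : ℝ} {P Q : Fin 4 → ℝ}
    (hP : m.form P P = m.epsSq * r ^ 2) (hQ : m.form Q Q = m.epsSq * r ^ 2)
    (hPQ : m.form P Q = m.epsSq * r ^ 2 * c) (t : ℝ) :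
    m.form ((1 - t) • P + t • Q) ((1 - t) • P + t • Q) =
      m.epsSq * r ^ 2 * (1 - 2 * t * (1 - t) * (1 - c)) := by
  rw [form_smul_add_smul, hP, hQ, hPQ]
  ring

lemma geodesicArc_eq (m : ModelSpace) {r c : ℝ} (hr : 0 < r) {P Q : Fin 4 → ℝ}
    (hP : m.form P P = m.epsSq * r ^ 2) (hQ : m.form Q Q = m.epsSq * r ^ 2)
    (hPQ : m.form P Q = m.epsSq * r ^ 2 * c) :
    m.geodesicArc r P Q = fun t =>
      (√(1 - 2 * t * (1 - t) * (1 - c)))⁻¹ • (P + t • (Q - P)) := by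
  funext t
  have h1 : m.epsSq * (m.epsSq * r ^ 2 * (1 - 2 * t * (1 - t) * (1 - c))) =
      r ^ 2 * (1 - 2 * t * (1 - t) * (1 - c)) := by
    linear_combination (r ^ 2 * (1 - 2 * t * (1 - t) * (1 - c))) * m.epsSq_mul_self
  have h2 : (1 - t) • P + t • Q = P + t • (Q - P) := by
    rw [sub_smul, smul_sub, one_smul]; abel
  rw [geodesicArc, radial, form_segment m hP hQ hPQ, h1, Real.sqrt_mul (sq_nonneg r),
    Real.sqrt_sq hr.le, h2, div_mul_eq_div_div, div_self hr.ne', one_div]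

/-- The squared speed of a geodesic arc, where the segment does not pass through the centre. -/
lemma form_deriv_geodesicArc (m : ModelSpace) {r c : ℝ} (hr : 0 < r) {P Q : Fin 4 → ℝ}
    (hP : m.form P P = m.epsSq * r ^ 2) (hQ : m.form Q Q = m.epsSq * r ^ 2)
    (hPQ : m.form P Q = m.epsSq * r ^ 2 * c) {t : ℝ}
    (hn : 0 < 1 - 2 * t * (1 - t) * (1 - c)) :
    m.form (deriv (m.geodesicArc r P Q) t) (deriv (m.geodesicArc r P Q) t) =
      r ^ 2 * (m.epsSq * (1 - c ^ 2)) / (1 - 2 * t * (1 - t) * (1 - c)) ^ 2 := by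
  rw [geodesicArc_eq m hr hP hQ hPQ]
  have hn' : HasDerivAt (fun t : ℝ => 1 - 2 * t * (1 - t) * (1 - c))
      (-(2 * (1 - 2 * t) * (1 - c))) t := by
    have h := ((((hasDerivAt_id t).const_mul 2).mul ((hasDerivAt_id t).const_sub 1)).mul_const
      (1 - c)).const_sub 1
    refine h.congr_deriv ?_
    simp only [id]; ring
  have hf := (hn'.sqrt hn.ne').inv (Real.sqrt_pos.2 hn).ne'
  have hN : HasDerivAt (fun t : ℝ => P + t • (Q - P)) (Q - P) t := by
    simpa using ((hasDerivAt_id t).smul_const (Q - P)).const_add P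
  have hγ := hf.smul hN
  rw [show deriv (fun t : ℝ => (√(1 - 2 * t * (1 - t) * (1 - c)))⁻¹ • (P + t • (Q - P))) t = _
    from hγ.deriv, form_smul_add_smul]
  have e1 : m.form (Q - P) (Q - P) = m.epsSq * r ^ 2 * (2 - 2 * c) := by
    have : m.form (Q - P) (Q - P) = m.form Q Q - 2 * m.form P Q + m.form P P := by
      simp only [form, Pi.sub_apply]; ring
    rw [this, hP, hQ, hPQ]; ring
  have e2 : m.form (Q - P) (P + t • (Q - P)) = m.epsSq * r ^ 2 * (-((1 - 2 * t) * (1 - c))) := by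
    have : m.form (Q - P) (P + t • (Q - P)) =
        m.form P Q - m.form P P + t * m.form (Q - P) (Q - P) := by
      simp only [form, Pi.sub_apply, Pi.add_apply, Pi.smul_apply, smul_eq_mul]; ring
    rw [this, e1, hP, hPQ]; ring
  have e3 : m.form (P + t • (Q - P)) (P + t • (Q - P)) =
      m.epsSq * r ^ 2 * (1 - 2 * t * (1 - t) * (1 - c)) := by
    rw [← form_segment m hP hQ hPQ t]
    congr 1 <;> · rw [sub_smul, smul_sub, one_smul]; abel
  rw [e1, e2, e3]
  obtain ⟨s, hs, hs2⟩ : ∃ s : ℝ, 0 < s ∧ 1 - 2 * t * (1 - t) * (1 - c) = s ^ 2 :=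
    ⟨_, Real.sqrt_pos.2 hn, (Real.sq_sqrt hn.le).symm⟩
  rw [Pi.inv_apply, hs2, Real.sqrt_sq hs.le]
  field_simp
  linear_combination (-2 * m.epsSq * (1 - c)) * hs2

/-- The inverse tangent of the geometry: `arctan` or `artanh`. -/
noncomputable def atn : ModelSpace → ℝ → ℝ
  | sphere => Real.arctan
  | hyperbolic => Real.artanh

/-- The tangent of the geometry: `tan` or `tanh`. -/
noncomputable def tn : ModelSpace → ℝ → ℝ
  | sphere => Real.tan
  | hyperbolic => Real.tanh

lemma atn_zero (m : ModelSpace) : m.atn 0 = 0 := by cases m <;> simp [atn]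

lemma atn_neg (m : ModelSpace) {x : ℝ} (hx : 0 < 1 + m.epsSq * x ^ 2) :
    m.atn (-x) = -m.atn x := by
  cases m
  · simp [atn]
  · simp only [epsSq, atn] at *
    have h : x ∈ Set.Ioo (-1 : ℝ) 1 := by
      rw [Set.mem_Ioo, ← abs_lt, ← sq_lt_one_iff_abs_lt_one]; linarith
    rw [Real.artanh_eq_half_log ⟨by linarith [h.2], by linarith [h.1]⟩,
      Real.artanh_eq_half_log ⟨h.1.le, h.2.le⟩,
      show (1 + -x) / (1 - -x) = ((1 + x) / (1 - x))⁻¹ by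
        rw [inv_div]; ring_nf, Real.log_inv]
    ring

lemma hasDerivAt_atn (m : ModelSpace) {x : ℝ} (hx : 0 < 1 + m.epsSq * x ^ 2) :
    HasDerivAt m.atn (1 / (1 + m.epsSq * x ^ 2)) x := by
  cases m
  · simpa [epsSq, atn] using Real.hasDerivAt_arctan x
  · simp only [epsSq, atn] at *
    have h : x ∈ Set.Ioo (-1 : ℝ) 1 := by
      rw [Set.mem_Ioo, ← abs_lt, ← sq_lt_one_iff_abs_lt_one]; linarith
    have h1 : 0 < 1 - x := by linarith [h.2]
    have h2 : 0 < 1 + x := by linarith [h.1]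
    have hd : HasDerivAt (fun x : ℝ => 1 / 2 * (Real.log (1 + x) - Real.log (1 - x)))
        (1 / 2 * (1 / (1 + x) - -1 / (1 - x))) x :=
      (((((hasDerivAt_id x).const_add 1).log h2.ne').sub
        (((hasDerivAt_id x).const_sub 1).log h1.ne'))).const_mul _
    refine (hd.congr_of_eventuallyEq ?_).congr_deriv ?_
    · filter_upwards [isOpen_Ioo.mem_nhds h] with y hy
      rw [Real.artanh_eq_half_log ⟨hy.1.le, hy.2.le⟩, Real.log_div (by linarith [hy.1])
        (by linarith [hy.2])]
    · have h3 : 1 + -1 * x ^ 2 ≠ 0 := by nlinarith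
      have h4 := h1.ne'
      have h5 := h2.ne'
      rw [show 1 + -1 * x ^ 2 = (1 + x) * (1 - x) by ring]
      field_simp
      ring

lemma tn_atn (m : ModelSpace) {x : ℝ} (hx : 0 < 1 + m.epsSq * x ^ 2) : m.tn (m.atn x) = x := by
  cases m
  · simp [atn, tn, Real.tan_arctan]
  · simp only [epsSq, atn, tn] at *
    refine Real.tanh_artanh ?_
    rw [Set.mem_Ioo, ← abs_lt, ← sq_lt_one_iff_abs_lt_one]; linarith

lemma one_add_mul_sq_pos_of_le {η x y : ℝ} (hη : η = 1 ∨ η = -1) (hx : 0 < 1 + η * x ^ 2)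
    (h : y ^ 2 ≤ x ^ 2) : 0 < 1 + η * y ^ 2 := by
  rcases hη with rfl | rfl <;> nlinarith [sq_nonneg y]

lemma epsSq_eq_or (m : ModelSpace) : m.epsSq = 1 ∨ m.epsSq = -1 := by cases m <;> simp [epsSq]

lemma continuousOn_div_one_add (m : ModelSpace) {k : ℝ} (g : ℝ → ℝ) (hg : Continuous g) {S : Set ℝ}
    (h : ∀ t ∈ S, 0 < 1 + m.epsSq * g t ^ 2) :
    ContinuousOn (fun t => k / (1 + m.epsSq * g t ^ 2)) S :=
  ContinuousOn.div continuousOn_const (by fun_prop) fun t ht => (h t ht).ne'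

/-- The length of a geodesic arc in terms of the tangent `τ` of half the angle. -/
lemma arcLength_eq (m : ModelSpace) {r c τ : ℝ} (hr : 0 < r) (hτ : 0 ≤ τ)
    (hτ' : 0 < 1 + m.epsSq * τ ^ 2) (hc : c = (1 - m.epsSq * τ ^ 2) / (1 + m.epsSq * τ ^ 2))
    {P Q : Fin 4 → ℝ}
    (hP : m.form P P = m.epsSq * r ^ 2) (hQ : m.form Q Q = m.epsSq * r ^ 2)
    (hPQ : m.form P Q = m.epsSq * r ^ 2 * c) :
    m.arcLength r P Q = 2 * r * m.atn τ := by
  have hpos : ∀ t ∈ Set.uIcc (0 : ℝ) 1, 0 < 1 + m.epsSq * (τ * (2 * t - 1)) ^ 2 := by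
    intro t ht
    rw [Set.uIcc_of_le zero_le_one] at ht
    refine one_add_mul_sq_pos_of_le m.epsSq_eq_or hτ' ?_
    have : (2 * t - 1) ^ 2 ≤ 1 := by nlinarith [ht.1, ht.2]
    nlinarith [sq_nonneg τ]
  have h1 : m.arcLength r P Q =
      ∫ t in (0 : ℝ)..1, 2 * r * τ / (1 + m.epsSq * (τ * (2 * t - 1)) ^ 2) := by
    refine intervalIntegral.integral_congr fun t ht => ?_
    have hp := hpos t ht
    -- The number τ(2t - 1) is the signed tangent of the angle measured from the midpoint of the
    -- arc. In this variable the speed is the derivative of r · atn.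
    have hn : 1 - 2 * t * (1 - t) * (1 - c) =
        (1 + m.epsSq * (τ * (2 * t - 1)) ^ 2) / (1 + m.epsSq * τ ^ 2) := by
      rw [hc]; field_simp; ring
    have hnp : 0 < 1 - 2 * t * (1 - t) * (1 - c) := by rw [hn]; positivity
    rw [form_deriv_geodesicArc m hr hP hQ hPQ hnp, hn]
    have : r ^ 2 * (m.epsSq * (1 - c ^ 2)) /
        ((1 + m.epsSq * (τ * (2 * t - 1)) ^ 2) / (1 + m.epsSq * τ ^ 2)) ^ 2 =
        (2 * r * τ / (1 + m.epsSq * (τ * (2 * t - 1)) ^ 2)) ^ 2 := by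
      generalize 1 + m.epsSq * (τ * (2 * t - 1)) ^ 2 = E at hp
      rw [hc]
      field_simp
      linear_combination 4 * τ ^ 2 * m.epsSq_mul_self
    rw [this, Real.sqrt_sq (by positivity)]
  have h2 : ∀ t ∈ Set.uIcc (0 : ℝ) 1, HasDerivAt (fun t => r * m.atn (τ * (2 * t - 1)))
      (2 * r * τ / (1 + m.epsSq * (τ * (2 * t - 1)) ^ 2)) t := by
    intro t ht
    have hl : HasDerivAt (fun t : ℝ => τ * (2 * t - 1)) (τ * 2) t := by
      simpa using (((hasDerivAt_id t).const_mul 2).sub_const 1).const_mul τ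
    refine (((m.hasDerivAt_atn (hpos t ht)).comp t hl).const_mul r).congr_deriv ?_
    ring
  rw [h1, intervalIntegral.integral_eq_sub_of_hasDerivAt h2
    (ContinuousOn.intervalIntegrable
      (m.continuousOn_div_one_add (fun t => τ * (2 * t - 1)) (by fun_prop) hpos))]
  have : τ * (2 * 0 - 1) = -τ := by ring
  rw [this, atn_neg m hτ']
  norm_num
  ring

/-- For c = -1 the factor 1 - c² in the squared speed vanishes except at t = 1/2, where the segment
passes through the centre. The integral defining the length is therefore 0, so a > 0 rules out
antipodal vertices. -/
lemma arcLength_antipodal (m : ModelSpace) {r : ℝ} (hr : 0 < r) {P Q : Fin 4 → ℝ}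
    (hP : m.form P P = m.epsSq * r ^ 2) (hQ : m.form Q Q = m.epsSq * r ^ 2)
    (hPQ : m.form P Q = m.epsSq * r ^ 2 * -1) : m.arcLength r P Q = 0 := by
  rw [arcLength]
  have h : ∀ᵐ t : ℝ, t ∈ Set.uIoc (0 : ℝ) 1 →
      √(m.form (deriv (m.geodesicArc r P Q) t) (deriv (m.geodesicArc r P Q) t)) = (0 : ℝ) := by
    filter_upwards [Measure.ae_ne volume (1 / 2 : ℝ)] with t ht _
    have hn : 0 < 1 - 2 * t * (1 - t) * (1 - -1) := by
      have : 0 < (2 * t - 1) ^ 2 := by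
        refine sq_pos_of_ne_zero fun h => ht (by linarith)
      nlinarith
    rw [form_deriv_geodesicArc m hr hP hQ hPQ hn]
    simp
  rw [intervalIntegral.integral_congr_ae h]
  simp

/-- The reversed Cauchy–Schwarz inequality on one sheet: ordinary Cauchy–Schwarz for the spatial
parts, with positivity of both last coordinates selecting the sign of the square root. -/
lemma cauchy_hyperbolic {r : ℝ} {P Q : Fin 4 → ℝ}
    (hP : P ∈ hyperbolic.space r) (hQ : Q ∈ hyperbolic.space r) :
    r ^ 2 ≤ -hyperbolic.form P Q := by
  obtain ⟨hP, hP0⟩ := hP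
  obtain ⟨hQ, hQ0⟩ := hQ
  have hp := hP0 rfl
  have hq := hQ0 rfl
  simp only [form, epsSq] at *
  set d := P 0 * Q 0 + P 1 * Q 1 + P 2 * Q 2 with hd
  set A := P 0 ^ 2 + P 1 ^ 2 + P 2 ^ 2 with hA
  set B := Q 0 ^ 2 + Q 1 ^ 2 + Q 2 ^ 2 with hB
  have hdAB : d ^ 2 ≤ A * B := by
    have : A * B - d ^ 2 = (P 0 * Q 1 - P 1 * Q 0) ^ 2 + (P 0 * Q 2 - P 2 * Q 0) ^ 2 +
        (P 1 * Q 2 - P 2 * Q 1) ^ 2 := by rw [hd, hA, hB]; ring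
    nlinarith [sq_nonneg (P 0 * Q 1 - P 1 * Q 0), sq_nonneg (P 0 * Q 2 - P 2 * Q 0),
      sq_nonneg (P 1 * Q 2 - P 2 * Q 1)]
  have hA3 : P 3 ^ 2 = A + r ^ 2 := by rw [hA]; linarith
  have hB3 : Q 3 ^ 2 = B + r ^ 2 := by rw [hB]; linarith
  have hA0 : 0 ≤ A := by positivity
  have hB0 : 0 ≤ B := by positivity
  have h2 : 2 * d ≤ A + B := by
    nlinarith [sq_nonneg (P 0 - Q 0), sq_nonneg (P 1 - Q 1), sq_nonneg (P 2 - Q 2)]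
  have h3 : (d + r ^ 2) ^ 2 ≤ (P 3 * Q 3) ^ 2 := by
    rw [mul_pow, hA3, hB3]
    nlinarith [sq_nonneg r]
  have h4 := (le_abs_self _).trans (abs_le_of_sq_le_sq h3 (by positivity))
  linarith

lemma cauchy_sphere {r : ℝ} {P Q : Fin 4 → ℝ}
    (hP : P ∈ sphere.space r) (hQ : Q ∈ sphere.space r) :
    |sphere.form P Q| ≤ r ^ 2 := by
  obtain ⟨hP, -⟩ := hP
  obtain ⟨hQ, -⟩ := hQ
  simp only [form, epsSq] at *
  rw [abs_le]
  constructor <;>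
  nlinarith [sq_nonneg (P 0 - Q 0), sq_nonneg (P 1 - Q 1), sq_nonneg (P 2 - Q 2),
    sq_nonneg (P 3 - Q 3), sq_nonneg (P 0 + Q 0), sq_nonneg (P 1 + Q 1), sq_nonneg (P 2 + Q 2),
    sq_nonneg (P 3 + Q 3)]

/-- The normalized inner product of two points is determined by their distance. -/
lemma form_eq_of_arcLength (m : ModelSpace) {r a : ℝ} (hr : 0 < r) (ha : 0 < a)
    {P Q : Fin 4 → ℝ} (hP : P ∈ m.space r) (hQ : Q ∈ m.space r) (h : m.arcLength r P Q = a) :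
    m.form P Q = m.epsSq * r ^ 2 *
      ((1 - m.epsSq * m.tn (a / (2 * r)) ^ 2) / (1 + m.epsSq * m.tn (a / (2 * r)) ^ 2)) := by
  obtain ⟨c, hc⟩ : ∃ c, m.form P Q = m.epsSq * r ^ 2 * c := by
    refine ⟨m.epsSq * m.form P Q / r ^ 2, ?_⟩
    field_simp
    linear_combination (-m.form P Q) * m.epsSq_mul_self
  have hr2 : 0 < r ^ 2 := by positivity
  have hc1 : 0 < 1 + c ∧ 0 ≤ m.epsSq * (1 - c) := by
    cases m
    · have h1 := cauchy_sphere hP hQ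
      rw [hc, abs_le] at h1
      simp only [epsSq] at *
      have h2 : -1 ≤ c := by nlinarith
      refine ⟨?_, by nlinarith⟩
      rcases h2.lt_or_eq with h3 | h3
      · linarith
      · subst h3
        have := arcLength_antipodal sphere hr hP.1 hQ.1 hc
        linarith
    · have h1 := cauchy_hyperbolic hP hQ
      rw [hc] at h1
      simp only [epsSq] at *
      have : 1 ≤ c := by nlinarith
      constructor <;> linarith
  obtain ⟨hc1, hc2⟩ := hc1
  -- The half-angle formula tan²(θ/2) = (1 - cos θ)/(1 + cos θ); the factor η corrects the sign when
  -- c is a hyperbolic cosine.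
  set τ := √(m.epsSq * (1 - c) / (1 + c)) with hτ
  have hτ2 : τ ^ 2 = m.epsSq * (1 - c) / (1 + c) := Real.sq_sqrt (by positivity)
  have hητ : m.epsSq * τ ^ 2 = (1 - c) / (1 + c) := by
    rw [hτ2]; linear_combination ((1 - c) / (1 + c)) * m.epsSq_mul_self
  have hpos : 0 < 1 + m.epsSq * τ ^ 2 := by
    rw [hητ, show 1 + (1 - c) / (1 + c) = 2 / (1 + c) by field_simp; ring]; positivity
  have hcτ : c = (1 - m.epsSq * τ ^ 2) / (1 + m.epsSq * τ ^ 2) := by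
    rw [eq_div_iff hpos.ne', hητ]; field_simp; ring
  have := arcLength_eq m hr (Real.sqrt_nonneg _) hpos hcτ hP.1 hQ.1 hc
  have h2 : a / (2 * r) = m.atn τ := by
    rw [← h, this, hτ]; field_simp
  rw [h2, tn_atn m hpos, ← hcτ, hc]

/-- The range of the half-edge tangent. -/
lemma tn_bounds (m : ModelSpace) {r a : ℝ} (hr : 0 < r) (ha : 0 < a)
    (hmax : m = sphere → a < 2 * Real.arctan (√2) * r) :
    0 < m.tn (a / (2 * r)) ∧ 0 < 1 + m.epsSq * m.tn (a / (2 * r)) ^ 2 ∧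
      0 < 2 - m.epsSq * m.tn (a / (2 * r)) ^ 2 ∧ m.atn (m.tn (a / (2 * r))) = a / (2 * r) := by
  have hx : 0 < a / (2 * r) := by positivity
  cases m
  · have h1 : a / (2 * r) < Real.arctan (√2) := by
      rw [div_lt_iff₀ (by positivity)]; linarith [hmax rfl]
    have h2 := h1.trans (Real.arctan_lt_pi_div_two _)
    simp only [tn, atn, epsSq]
    have h3 := Real.tan_pos_of_pos_of_lt_pi_div_two hx h2
    have h4 : Real.tan (a / (2 * r)) < √2 := by
      rw [← Real.tan_arctan (√2)]
      exact Real.tan_lt_tan_of_lt_of_lt_pi_div_two (by linarith) (Real.arctan_lt_pi_div_two _) h1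
    refine ⟨h3, by positivity, ?_, Real.arctan_tan (by linarith) h2⟩
    have h5 : Real.tan (a / (2 * r)) ^ 2 < 2 := by
      have := pow_lt_pow_left₀ h4 h3.le two_ne_zero
      rwa [Real.sq_sqrt (by norm_num)] at this
    linarith
  · simp only [tn, atn, epsSq]
    have h1 := Real.tanh_lt_one (a / (2 * r))
    have h2 : 0 < Real.tanh (a / (2 * r)) := by
      rw [Real.tanh_eq_sinh_div_cosh]
      exact div_pos (Real.sinh_pos_iff.2 hx) (Real.cosh_pos _)
    refine ⟨h2, by nlinarith, by nlinarith, Real.artanh_tanh _⟩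

end ModelSpace

/-! ### Lebesgue measure of solid cones by affine slices -/

/-- The point `(x, z)` of `ℝ⁴`. -/
def affinePoint (z : ℝ) (x : Fin 3 → ℝ) : Fin 4 → ℝ := ![x 0, x 1, x 2, z]

lemma affinePoint_smul (k z : ℝ) (x : Fin 3 → ℝ) :
    affinePoint (k * z) (k • x) = k • affinePoint z x := by
  ext i; fin_cases i <;> simp [affinePoint]

lemma affinePoint_add_smul (z t : ℝ) (x v : Fin 3 → ℝ) :
    affinePoint z (x + t • v) = affinePoint z x + t • affinePoint 0 v := by
  ext i; fin_cases i <;> simp [affinePoint]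

lemma continuous_affinePoint : Continuous fun p : ℝ × (Fin 3 → ℝ) => affinePoint p.1 p.2 := by
  refine continuous_pi fun i => ?_
  fin_cases i <;> simp only [affinePoint] <;> dsimp <;> fun_prop

lemma continuous_affinePoint_right (z : ℝ) : Continuous (affinePoint z) :=
  continuous_affinePoint.comp (Continuous.prodMk_right z)

lemma volume_eq_prod_affinePoint {S : Set (Fin 4 → ℝ)} (hS : MeasurableSet S) :
    volume S = ∫⁻ z : ℝ, volume {x : Fin 3 → ℝ | affinePoint z x ∈ S} := by
  have h := (volume_preserving_piFinSuccAbove (fun _ : Fin 4 => ℝ) 3).symm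
  rw [← h.measure_preimage hS.nullMeasurableSet, Measure.volume_eq_prod,
    Measure.prod_apply ((MeasurableEquiv.measurable _) hS)]
  refine lintegral_congr fun z => ?_
  congr 1
  ext x
  simp only [Set.mem_preimage, Set.mem_ofPred_eq]
  congr! 1
  ext i
  fin_cases i <;> simp [affinePoint, MeasurableEquiv.piFinSuccAbove] <;> rfl

/-- The volume of a homogeneous sublevel set in a cone, as an integral over an affine slice. -/
lemma volume_cone_slice {K : Set (Fin 4 → ℝ)} (hK : MeasurableSet K)
    (hcone : ∀ X ∈ K, ∀ k : ℝ, 0 < k → k • X ∈ K) {Q : (Fin 4 → ℝ) → ℝ} (hQ : Continuous Q)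
    (hQs : ∀ (k : ℝ) (X : Fin 4 → ℝ), Q (k • X) = k ^ 2 * Q X) {r ρ : ℝ} (hr : 0 < r) (hρ : 0 < ρ)
    (hpos : ∀ X ∈ K, 0 < X 3 → 0 < Q X) :
    volume {X | X ∈ K ∧ 0 < X 3 ∧ Q X ≤ ρ ^ 2} =
      ∫⁻ x in {x | affinePoint r x ∈ K},
        ENNReal.ofReal (r * ρ ^ 4 / (4 * Q (affinePoint r x) ^ 2)) := by
  have hA : MeasurableSet {x | affinePoint r x ∈ K} := (continuous_affinePoint_right r).measurable hK
  have hS : MeasurableSet {X : Fin 4 → ℝ | X ∈ K ∧ 0 < X 3 ∧ Q X ≤ ρ ^ 2} :=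
    hK.inter ((measurableSet_lt measurable_const (measurable_pi_apply 3)).inter
      (measurableSet_le hQ.measurable measurable_const))
  rw [volume_eq_prod_affinePoint hS]
  let B : Set (ℝ × (Fin 3 → ℝ)) :=
    {p | affinePoint r p.2 ∈ K ∧ 0 < p.1 ∧ (p.1 / r) ^ 2 * Q (affinePoint r p.2) ≤ ρ ^ 2}
  have hB : MeasurableSet B := by
    refine (measurable_snd hA).inter ((measurableSet_lt measurable_const measurable_fst).inter
      (measurableSet_le (f := fun p : ℝ × (Fin 3 → ℝ) =>
        (p.1 / r) ^ 2 * Q (affinePoint r p.2)) ?_ measurable_const))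
    have := hQ.comp ((continuous_affinePoint_right r).comp (continuous_snd (X := ℝ)))
    exact (((continuous_fst.div_const r).pow 2).mul this).measurable
  have hslice : ∀ z : ℝ, volume {x : Fin 3 → ℝ | affinePoint z x ∈
      {X : Fin 4 → ℝ | X ∈ K ∧ 0 < X 3 ∧ Q X ≤ ρ ^ 2}} =
      ∫⁻ x, B.indicator (fun p => ENNReal.ofReal ((p.1 / r) ^ 3)) (z, x) := by
    intro z
    have h1 : ∀ x, B.indicator (fun p => ENNReal.ofReal ((p.1 / r) ^ 3)) (z, x) =
        (Prod.mk z ⁻¹' B).indicator (fun _ => ENNReal.ofReal ((z / r) ^ 3)) x := by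
      intro x; rfl
    simp_rw [h1]
    rw [lintegral_indicator (measurable_prodMk_left hB), setLIntegral_const]
    rcases le_or_gt z 0 with hz | hz
    · have e1 : {x : Fin 3 → ℝ | affinePoint z x ∈
          {X : Fin 4 → ℝ | X ∈ K ∧ 0 < X 3 ∧ Q X ≤ ρ ^ 2}} = ∅ := by
        ext x; simp [affinePoint, hz.not_gt]
      have e2 : Prod.mk z ⁻¹' B = ∅ := by
        ext x; simp [B, hz.not_gt]
      rw [e1, e2]; simp
    · have hk : 0 < z / r := by positivity
      -- The slice of the cone at height z > 0 is the z/r-dilate of a subset of the slice at height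
      -- r, which accounts for the weight (z/r)³.
      have key : ∀ x, affinePoint z ((z / r) • x) = (z / r) • affinePoint r x := by
        intro x; rw [← affinePoint_smul, div_mul_cancel₀ _ hr.ne']
      have e1 : {x : Fin 3 → ℝ | affinePoint z x ∈
          {X : Fin 4 → ℝ | X ∈ K ∧ 0 < X 3 ∧ Q X ≤ ρ ^ 2}} =
          (fun x => (z / r)⁻¹ • x) ⁻¹' (Prod.mk z ⁻¹' B) := by
        ext x
        obtain ⟨y, rfl⟩ : ∃ y, x = (z / r) • y := ⟨(z / r)⁻¹ • x, by
          rw [smul_inv_smul₀ hk.ne']⟩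
        have hz3 : 0 < ((z / r) • affinePoint r y) 3 := by
          rw [← key]; simpa [affinePoint] using hz
        simp only [Set.mem_ofPred_eq, Set.mem_preimage, true_and, B,
          inv_smul_smul₀ hk.ne', hz, key, hQs, hz3]
        refine and_congr_left' ⟨fun h => ?_, fun h => hcone _ h _ hk⟩
        have := hcone _ h _ (inv_pos.2 hk)
        rwa [inv_smul_smul₀ hk.ne'] at this
      rw [e1, Measure.addHaar_preimage_smul _ (inv_ne_zero hk.ne')]
      congr 1
      rw [abs_of_pos (by positivity)]
      simp [← inv_pow]
  simp_rw [hslice]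
  rw [lintegral_lintegral_swap]
  swap
  · exact ((Measurable.indicator (by fun_prop) hB)).aemeasurable
  rw [← lintegral_indicator hA]
  refine lintegral_congr fun x => ?_
  by_cases hx : affinePoint r x ∈ K
  swap
  · simp [Set.indicator, B, hx]
  rw [Set.indicator_of_mem (show x ∈ {x | affinePoint r x ∈ K} from hx)]
  have hq : 0 < Q (affinePoint r x) := hpos _ hx (by simpa [affinePoint] using hr)
  set q := Q (affinePoint r x) with hqd
  have hsq : 0 < √q := Real.sqrt_pos.2 hq
  -- The height at which the ray through (x, r) leaves {Q ≤ ρ²}. The integral of (z/r)³ over (0, b]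
  -- is b⁴/(4r³) = rρ⁴/(4q²).
  set b := r * ρ / √q with hb
  have hb0 : 0 < b := by positivity
  have h2 : ∀ z : ℝ, B.indicator (fun p => ENNReal.ofReal ((p.1 / r) ^ 3)) (z, x) =
      (Set.Ioc 0 b).indicator (fun z => ENNReal.ofReal ((z / r) ^ 3)) z := by
    intro z
    simp only [Set.indicator]
    congr 1
    simp only [B, Set.mem_ofPred_eq, hx, true_and, Set.mem_Ioc, eq_iff_iff, ← hqd]
    refine and_congr_right fun hz => ?_
    rw [hb, le_div_iff₀ hsq]
    have h3 : (z / r) ^ 2 * q = (z * √q / r) ^ 2 := by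
      rw [div_pow, div_pow, mul_pow, Real.sq_sqrt hq.le]; ring
    rw [h3, pow_le_pow_iff_left₀ (by positivity) hρ.le two_ne_zero, div_le_iff₀ hr, mul_comm ρ]
  simp_rw [h2]
  rw [lintegral_indicator measurableSet_Ioc, ← ofReal_integral_eq_lintegral_ofReal]
  · rw [← intervalIntegral.integral_of_le hb0.le]
    congr 1
    simp only [div_pow, intervalIntegral.integral_div, integral_pow]
    have : b ^ 4 = r ^ 4 * ρ ^ 4 / q ^ 2 := by
      rw [hb, div_pow, mul_pow, show √q ^ 4 = (√q ^ 2) ^ 2 by ring, Real.sq_sqrt hq.le]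
    norm_num [this]
    field_simp
  · exact (Continuous.integrableOn_Icc (by fun_prop)).mono_set Set.Ioc_subset_Icc_self
  · filter_upwards [self_mem_ae_restrict measurableSet_Ioc] with z hz
    have := hz.1
    simp only [Pi.zero_apply]
    positivity

/-! ### The Riemannian metric in Klein coordinates -/

namespace ModelSpace

/-- The quadratic form `ε² ⟨(x, r), (x, r)⟩ = r² + ε² |x|²`. -/
def kleinForm (m : ModelSpace) (r : ℝ) (x : Fin 3 → ℝ) : ℝ :=
  r ^ 2 + m.epsSq * (x 0 ^ 2 + x 1 ^ 2 + x 2 ^ 2)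

lemma form_affinePoint (m : ModelSpace) (r : ℝ) (x : Fin 3 → ℝ) :
    m.epsSq * m.form (affinePoint r x) (affinePoint r x) = m.kleinForm r x := by
  simp only [form, affinePoint, kleinForm]
  simp
  linear_combination (r ^ 2) * m.epsSq_mul_self

lemma kleinInv_eq (m : ModelSpace) (r s : ℝ) (x : Fin 3 → ℝ) :
    m.kleinInv r s x = (s * (r / √(m.kleinForm r x))) • affinePoint r x := by
  rw [kleinInv, radial, smul_smul]
  change (s * (r / √(m.epsSq * m.form (affinePoint r x) (affinePoint r x)))) •
    affinePoint r x = _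
  rw [form_affinePoint]

lemma fderiv_kleinInv (m : ModelSpace) (r s : ℝ) {x : Fin 3 → ℝ} (hx : 0 < m.kleinForm r x)
    (v : Fin 3 → ℝ) :
    fderiv ℝ (m.kleinInv r s) x v = (s * r * (√(m.kleinForm r x))⁻¹) • affinePoint 0 v +
      (-(s * r * (m.epsSq * (x 0 * v 0 + x 1 * v 1 + x 2 * v 2)) *
        (√(m.kleinForm r x))⁻¹ ^ 3)) • affinePoint r x := by
  have hf : m.kleinInv r s = fun x => (s * (r / √(m.kleinForm r x))) • affinePoint r x :=
    funext (m.kleinInv_eq r s)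
  have hq : Differentiable ℝ (m.kleinForm r) := by
    unfold kleinForm; fun_prop
  have ha : Differentiable ℝ (affinePoint r) := by
    refine differentiable_pi.2 fun i => ?_
    fin_cases i <;> simp only [affinePoint] <;> dsimp <;> fun_prop
  have hd : DifferentiableAt ℝ (m.kleinInv r s) x := by
    rw [hf]
    have hd1 : DifferentiableAt ℝ (fun x => s * (r / √(m.kleinForm r x))) x := by
      have h1 := (hq x).sqrt hx.ne'
      have h2 := (Real.sqrt_pos.2 hx).ne'
      simp only [div_eq_mul_inv]
      exact ((h1.inv h2).const_mul r).const_mul s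
    exact hd1.fun_smul (ha x)
  -- Along the line x + t v the form is a quadratic polynomial in t, so the derivative reduces to
  -- one-variable calculus.
  rw [← hd.lineDeriv_eq_fderiv]
  refine HasLineDerivAt.lineDeriv ?_
  have hS := Real.sqrt_pos.2 hx
  have hq' : HasDerivAt (fun t : ℝ => m.kleinForm r (x + t • v))
      (2 * (m.epsSq * (x 0 * v 0 + x 1 * v 1 + x 2 * v 2))) 0 := by
    have e : (fun t : ℝ => m.kleinForm r (x + t • v)) = fun t => m.kleinForm r x +
        t * (2 * (m.epsSq * (x 0 * v 0 + x 1 * v 1 + x 2 * v 2))) +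
        t ^ 2 * (m.epsSq * (v 0 ^ 2 + v 1 ^ 2 + v 2 ^ 2)) := by
      funext t
      simp only [kleinForm, Pi.add_apply, Pi.smul_apply, smul_eq_mul]; ring
    rw [e]
    refine ((((hasDerivAt_id (0 : ℝ)).mul_const _).const_add _).add
      (((hasDerivAt_id (0 : ℝ)).pow 2).mul_const _)).congr_deriv ?_
    simp
  have hx0 : m.kleinForm r (x + (0 : ℝ) • v) = m.kleinForm r x := by simp
  have h1 := ((hq'.sqrt (by rw [hx0]; exact hx.ne')).inv
    (by rw [hx0]; exact hS.ne')).const_mul (s * r)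
  have h2 : HasDerivAt (fun t : ℝ => affinePoint r x + t • affinePoint 0 v)
      (affinePoint 0 v) 0 := by
    simpa using ((hasDerivAt_id (0 : ℝ)).smul_const (affinePoint 0 v)).const_add (affinePoint r x)
  have h3 := h1.smul h2
  have e : (fun t : ℝ => m.kleinInv r s (x + t • v)) =
      (fun t : ℝ => s * r * (√(m.kleinForm r (x + t • v)))⁻¹) •
        fun t : ℝ => affinePoint r x + t • affinePoint 0 v := by
    funext t
    rw [kleinInv_eq, affinePoint_add_smul, Pi.smul_apply', div_eq_mul_inv, mul_assoc]
  unfold HasLineDerivAt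
  rw [e]
  refine h3.congr_deriv ?_
  simp only [zero_smul, add_zero, Pi.inv_apply]
  congr 2
  field_simp

lemma metricMatrix_apply (m : ModelSpace) {r s : ℝ} (hs : s ^ 2 = 1) {x : Fin 3 → ℝ}
    (hx : 0 < m.kleinForm r x) (A B : Fin 3) :
    m.metricMatrix r s x A B = r ^ 2 * ((if A = B then 1 else 0) / m.kleinForm r x -
      m.epsSq * x A * x B / m.kleinForm r x ^ 2) := by
  obtain ⟨k, hk, hk2⟩ : ∃ k : ℝ, 0 < k ∧ m.kleinForm r x = k ^ 2 :=
    ⟨_, Real.sqrt_pos.2 hx, (Real.sq_sqrt hx.le).symm⟩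
  have hsum : ∀ A : Fin 3, x 0 * (Pi.single A 1 : Fin 3 → ℝ) 0 +
      x 1 * (Pi.single A 1 : Fin 3 → ℝ) 1 + x 2 * (Pi.single A 1 : Fin 3 → ℝ) 2 = x A := by
    intro A; fin_cases A <;> simp
  rw [metricMatrix, Matrix.of_apply, fderiv_kleinInv m r s hx, fderiv_kleinInv m r s hx,
    hsum, hsum, hk2, Real.sqrt_sq hk.le]
  have hform : ∀ a b a' b' : ℝ, m.form
      (a • affinePoint 0 (Pi.single A 1) + b • affinePoint r x)
      (a' • affinePoint 0 (Pi.single B 1) + b' • affinePoint r x) =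
      a * a' * (if A = B then 1 else 0) + a * b' * x A + b * a' * x B +
        b * b' * (m.epsSq * k ^ 2) := by
    intro a b a' b'
    have : m.epsSq * k ^ 2 = x 0 ^ 2 + x 1 ^ 2 + x 2 ^ 2 + m.epsSq * r ^ 2 := by
      rw [← hk2, kleinForm]
      linear_combination (x 0 ^ 2 + x 1 ^ 2 + x 2 ^ 2) * m.epsSq_mul_self
    rw [this]
    fin_cases A <;> fin_cases B <;> simp [form, affinePoint] <;> ring
  rw [hform]
  have hs2 : s * s = 1 := by rw [← hs]; ring
  field_simp
  rcases m.epsSq_eq_or with h | h <;> rw [h] <;> ring_nf <;> rw [hs] <;> ring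

/-- The volume density in Klein coordinates. -/
lemma sqrt_det_metricMatrix (m : ModelSpace) {r s : ℝ} (hs : s ^ 2 = 1) {x : Fin 3 → ℝ}
    (hx : 0 < m.kleinForm r x) :
    √|(m.metricMatrix r s x).det| = r ^ 4 / m.kleinForm r x ^ 2 := by
  -- The matrix is a rank-one perturbation (r²/q)(I - η x xᵀ/q), with determinant (r⁶/q³)(1 -
  -- η|x|²/q) = r⁸/q⁴ because q - η|x|² = r².
  have h : (m.metricMatrix r s x).det = (r ^ 4 / m.kleinForm r x ^ 2) ^ 2 := by
    rw [Matrix.det_fin_three]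
    simp only [metricMatrix_apply m hs hx]
    have hq : m.kleinForm r x = r ^ 2 + m.epsSq * (x 0 ^ 2 + x 1 ^ 2 + x 2 ^ 2) := rfl
    simp
    generalize m.kleinForm r x = q at *
    field_simp
    rcases m.epsSq_eq_or with h | h <;> rw [h] at hq ⊢ <;>
      linear_combination (r ^ 6 * q ^ 2) * hq
  rw [h, abs_of_nonneg (sq_nonneg _), Real.sqrt_sq (by positivity)]

end ModelSpace

/-! ### Cones over equiangular vertices -/

/-- The convex cone spanned by four vectors. -/
def coneHull (P : Fin 4 → Fin 4 → ℝ) : Set (Fin 4 → ℝ) :=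
  {X | ∃ w : Fin 4 → ℝ, (∀ i, 0 ≤ w i) ∧ X = ∑ i, w i • P i}

/-- The quadratic form with Gram matrix `1` on and `c` off the diagonal. -/
def equiangularForm (c : ℝ) (w : Fin 4 → ℝ) : ℝ := c * (∑ i, w i) ^ 2 + (1 - c) * ∑ i, w i ^ 2

lemma coneHull_smul {P : Fin 4 → Fin 4 → ℝ} {X : Fin 4 → ℝ} (hX : X ∈ coneHull P) {k : ℝ}
    (hk : 0 ≤ k) : k • X ∈ coneHull P := by
  obtain ⟨w, hw, rfl⟩ := hX
  exact ⟨k • w, fun i => mul_nonneg hk (hw i), by simp [Finset.smul_sum, mul_smul]⟩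

lemma coneHull_smul_iff {P : Fin 4 → Fin 4 → ℝ} {X : Fin 4 → ℝ} {k : ℝ} (hk : 0 < k) :
    k • X ∈ coneHull P ↔ X ∈ coneHull P :=
  ⟨fun h => by simpa [smul_smul, hk.ne'] using coneHull_smul h (inv_pos.2 hk).le,
    fun h => coneHull_smul h hk.le⟩

lemma coneHull_eq_image (P : Fin 4 → Fin 4 → ℝ) :
    coneHull P = Matrix.toLin' (Matrix.of P).transpose '' {w | ∀ i, 0 ≤ w i} := by
  ext X
  simp only [coneHull, Set.mem_ofPred_eq, Set.mem_image]
  refine exists_congr fun w => and_congr_right fun _ => ?_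
  rw [eq_comm]
  congr! 1
  ext j
  simp [Matrix.toLin'_apply, Matrix.mulVec, dotProduct, Matrix.transpose_apply, mul_comm]

lemma measurableSet_coneHull {P : Fin 4 → Fin 4 → ℝ} (hP : (Matrix.of P).det ≠ 0) :
    MeasurableSet (coneHull P) := by
  rw [coneHull_eq_image]
  have hinj : Function.Injective (Matrix.toLin' (Matrix.of P).transpose) := by
    rw [Matrix.toLin'_apply']
    apply Matrix.mulVec_injective_of_isUnit
    rw [Matrix.isUnit_iff_isUnit_det, Matrix.det_transpose]
    exact isUnit_iff_ne_zero.2 hP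
  have hc : Continuous (Matrix.toLin' (Matrix.of P).transpose) :=
    LinearMap.continuous_of_finiteDimensional _
  refine MeasurableSet.image_of_continuousOn_injOn ?_ hc.continuousOn hinj.injOn
  rw [Set.ofPred_forall]
  exact MeasurableSet.iInter fun i => measurableSet_le measurable_const (measurable_pi_apply i)

/-- Let S = (∑ w)² and N = ∑ w². For c ≥ 0, nonnegativity of w gives S ≥ N and the form is at least
N; for c < 0, Cauchy–Schwarz gives S ≤ 4N and the form is at least (1 + 3c)N. In the hyperbolic case
c > 1, so the form is indefinite and the restriction to w ≥ 0 is essential. -/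
lemma equiangularForm_pos {c : ℝ} (hc : 0 < 1 + 3 * c) {w : Fin 4 → ℝ} (hw : ∀ i, 0 ≤ w i)
    (hw0 : w ≠ 0) : 0 < equiangularForm c w := by
  have hN : 0 < ∑ i, w i ^ 2 := by
    refine lt_of_le_of_ne (Finset.sum_nonneg fun i _ => sq_nonneg _) fun h => hw0 ?_
    rw [eq_comm, Finset.sum_eq_zero_iff_of_nonneg fun i _ => sq_nonneg _] at h
    funext i
    exact pow_eq_zero_iff two_ne_zero |>.1 (h i (Finset.mem_univ i))
  have h1 : (∑ i, w i) ^ 2 ≤ 4 * ∑ i, w i ^ 2 := by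
    simpa using sq_sum_le_card_mul_sum_sq (s := Finset.univ) (f := w)
  have h2 : ∑ i, w i ^ 2 ≤ (∑ i, w i) ^ 2 := by
    have := fun i j => mul_nonneg (hw i) (hw j)
    simp only [Fin.sum_univ_four]
    nlinarith [this 0 1, this 0 2, this 0 3, this 1 2, this 1 3, this 2 3]
  unfold equiangularForm
  generalize ∑ i, w i ^ 2 = N at *
  generalize (∑ i, w i) ^ 2 = S at *
  rcases le_or_gt 0 c with h | h <;> nlinarith

namespace ModelSpace

/-- Four points of the space with equal mutual inner products `ε² r² c`. -/
structure IsEquiangular (m : ModelSpace) (r c : ℝ) (P : Fin 4 → Fin 4 → ℝ) : Prop where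
  mem : ∀ i, P i ∈ m.space r
  form_eq : ∀ i j, i ≠ j → m.form (P i) (P j) = m.epsSq * r ^ 2 * c

variable {m : ModelSpace} {r c : ℝ} {P : Fin 4 → Fin 4 → ℝ}

lemma IsEquiangular.form_sum (h : m.IsEquiangular r c P) (w : Fin 4 → ℝ) :
    m.epsSq * m.form (∑ i, w i • P i) (∑ i, w i • P i) = r ^ 2 * equiangularForm c w := by
  have h1 : m.form (∑ i, w i • P i) (∑ i, w i • P i) =
      ∑ i, w i ^ 2 * m.form (P i) (P i) + 2 * (w 0 * w 1 * m.form (P 0) (P 1) +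
        w 0 * w 2 * m.form (P 0) (P 2) + w 0 * w 3 * m.form (P 0) (P 3) +
        w 1 * w 2 * m.form (P 1) (P 2) + w 1 * w 3 * m.form (P 1) (P 3) +
        w 2 * w 3 * m.form (P 2) (P 3)) := by
    simp only [Fin.sum_univ_four, form, Pi.add_apply, Pi.smul_apply, smul_eq_mul]
    ring
  rw [h1, h.form_eq 0 1 (by decide), h.form_eq 0 2 (by decide), h.form_eq 0 3 (by decide),
    h.form_eq 1 2 (by decide), h.form_eq 1 3 (by decide), h.form_eq 2 3 (by decide)]
  simp only [Fin.sum_univ_four, (h.mem _).1, equiangularForm]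
  linear_combination (r ^ 2 * (c * (w 0 + w 1 + w 2 + w 3) ^ 2 +
    (1 - c) * (w 0 ^ 2 + w 1 ^ 2 + w 2 ^ 2 + w 3 ^ 2))) * m.epsSq_mul_self

/-- The matrix P · diag(1, 1, 1, η) · Pᵀ is the Gram matrix ηr²J, where J has 1 on and c off the
diagonal, and det J = (1 - c)³(1 + 3c). -/
lemma IsEquiangular.sq_det (h : m.IsEquiangular r c P) :
    (Matrix.of P).det ^ 2 = (r ^ 4) ^ 2 * ((m.epsSq * (1 - c)) ^ 3 * (1 + 3 * c)) := by
  have hG : Matrix.of P * Matrix.diagonal ![1, 1, 1, m.epsSq] * (Matrix.of P).transpose =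
      (m.epsSq * r ^ 2) • !![1, c, c, c; c, 1, c, c; c, c, 1, c; c, c, c, 1] := by
    ext i j
    have e : (Matrix.of P * Matrix.diagonal ![1, 1, 1, m.epsSq] * (Matrix.of P).transpose) i j =
        m.form (P i) (P j) := by
      simp [Matrix.mul_apply, Fin.sum_univ_four, form, Matrix.diagonal]
      ring
    rw [e]
    by_cases hij : i = j
    · subst hij
      rw [(h.mem i).1]
      fin_cases i <;> simp
    · rw [h.form_eq i j hij]
      fin_cases i <;> fin_cases j <;> simp at hij ⊢
  have hd := congrArg Matrix.det hG
  have hJ : !![1, c, c, c; c, 1, c, c; c, c, 1, c; c, c, c, 1].det =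
      (1 - c) ^ 3 * (1 + 3 * c) := by
    simp [Matrix.det_succ_row_zero, Fin.sum_univ_succ, Fin.succAbove]
    ring
  rw [Matrix.det_mul, Matrix.det_mul, Matrix.det_transpose, Matrix.det_diagonal,
    Matrix.det_smul, hJ] at hd
  simp [Fin.prod_univ_four] at hd
  have h2 := m.epsSq_mul_self
  rcases m.epsSq_eq_or with h' | h' <;> rw [h'] at hd ⊢ <;> linarith

lemma IsEquiangular.abs_det (hr : 0 < r) (h : m.IsEquiangular r c P) :
    |(Matrix.of P).det| = r ^ 4 * √((m.epsSq * (1 - c)) ^ 3 * (1 + 3 * c)) := by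
  rw [← Real.sqrt_sq_eq_abs, h.sq_det, Real.sqrt_mul (sq_nonneg _),
    Real.sqrt_sq (by positivity)]

lemma IsEquiangular.det_ne_zero (hr : 0 < r) (h : m.IsEquiangular r c P)
    (h1 : 0 < m.epsSq * (1 - c)) (h2 : 0 < 1 + 3 * c) : (Matrix.of P).det ≠ 0 := by
  rw [← abs_pos, h.abs_det hr]
  positivity

/-- The condition on the last coordinate serves only to exclude X = 0. -/
lemma IsEquiangular.form_pos (hr : 0 < r) (h : m.IsEquiangular r c P) (h2 : 0 < 1 + 3 * c)
    {X : Fin 4 → ℝ} (hX : X ∈ coneHull P) (hX0 : X 3 ≠ 0) : 0 < m.epsSq * m.form X X := by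
  obtain ⟨w, hw, rfl⟩ := hX
  rw [h.form_sum]
  have : w ≠ 0 := by rintro rfl; simp at hX0
  have := equiangularForm_pos h2 hw this
  positivity

lemma IsEquiangular.nonneg_of_hyperbolic (h : hyperbolic.IsEquiangular r c P)
    {X : Fin 4 → ℝ} (hX : X ∈ coneHull P) : 0 ≤ X 3 := by
  obtain ⟨w, hw, rfl⟩ := hX
  rw [Finset.sum_apply]
  exact Finset.sum_nonneg fun i _ => mul_nonneg (hw i) ((h.mem i).2 rfl).le

lemma mem_kleinDomain {x : Fin 3 → ℝ} : x ∈ m.kleinDomain r ↔ 0 < m.kleinForm r x := by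
  simp [kleinDomain, kleinForm, Fin.sum_univ_three]

lemma form_smul_affinePoint (s : ℝ) (hs : s ^ 2 = 1) (x : Fin 3 → ℝ) :
    m.epsSq * m.form (s • affinePoint r x) (s • affinePoint r x) = m.kleinForm r x := by
  rw [← form_affinePoint]
  simp only [form, Pi.smul_apply, smul_eq_mul]
  linear_combination (m.epsSq * (affinePoint r x 0 ^ 2 + affinePoint r x 1 ^ 2 +
    affinePoint r x 2 ^ 2 + m.epsSq * affinePoint r x 3 ^ 2)) * hs

/-- The points of a chart that lie in a tetrahedron. -/
lemma IsEquiangular.chart_set_eq (hr : 0 < r) (h : m.IsEquiangular r c P) (h2 : 0 < 1 + 3 * c)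
    {s : ℝ} (hs : s ^ 2 = 1) :
    {x | x ∈ m.kleinDomain r ∧ m.kleinInv r s x ∈ m.space r ∩ m.tetrahedron r P} =
      {x | s • affinePoint r x ∈ coneHull P} := by
  ext x
  simp only [Set.mem_ofPred_eq, mem_kleinDomain]
  have key : 0 < m.kleinForm r x →
      (m.kleinInv r s x ∈ coneHull P ↔ s • affinePoint r x ∈ coneHull P) := by
    intro hq
    have : 0 < r / √(m.kleinForm r x) := div_pos hr (Real.sqrt_pos.2 hq)
    rw [kleinInv_eq, mul_comm, mul_smul, coneHull_smul_iff this]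
  constructor
  · rintro ⟨hq, -, -, hT⟩
    exact (key hq).1 hT
  · intro hx
    have hs0 : s ≠ 0 := by rintro rfl; simp at hs
    have hx3 : (s • affinePoint r x) 3 ≠ 0 := by simp [affinePoint, hs0, hr.ne']
    -- The whole cone away from 0 lies where η⟨X,X⟩ > 0, so membership in the Klein domain is
    -- automatic.
    have hq : 0 < m.kleinForm r x := by
      rw [← form_smul_affinePoint s hs]
      exact h.form_pos hr h2 hx hx3
    have hsp : m.kleinInv r s x ∈ m.space r := by
      constructor
      · have e : m.form (m.kleinInv r s x) (m.kleinInv r s x) =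
            (r / √(m.kleinForm r x)) ^ 2 *
              (m.epsSq * m.epsSq * m.form (s • affinePoint r x) (s • affinePoint r x)) := by
          rw [m.epsSq_mul_self, kleinInv_eq]
          simp only [form, Pi.smul_apply, smul_eq_mul]; ring
        rw [e, mul_assoc m.epsSq, form_smul_affinePoint s hs, div_pow, Real.sq_sqrt hq.le]
        field_simp
      · rintro rfl
        have h3 := h.nonneg_of_hyperbolic ((key hq).2 hx)
        refine lt_of_le_of_ne h3 (Ne.symm ?_)
        rw [kleinInv_eq]
        simp [affinePoint, hr.ne', hs0, (Real.sqrt_pos.2 hq).ne']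
    exact ⟨hq, hsp, hsp, (key hq).2 hx⟩

lemma IsEquiangular.measurableSet_chart (hr : 0 < r) (h : m.IsEquiangular r c P)
    (h1 : 0 < m.epsSq * (1 - c)) (h2 : 0 < 1 + 3 * c) (s : ℝ) :
    MeasurableSet {x : Fin 3 → ℝ | s • affinePoint r x ∈ coneHull P} :=
  ((continuous_affinePoint_right r).const_smul s).measurable
    (measurableSet_coneHull (h.det_ne_zero hr h1 h2))

lemma IsEquiangular.chartVolume_eq (hr : 0 < r) (h : m.IsEquiangular r c P)
    (h1 : 0 < m.epsSq * (1 - c)) (h2 : 0 < 1 + 3 * c) {s : ℝ} (hs : s ^ 2 = 1) :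
    m.chartVolume r s (m.tetrahedron r P) =
      ∫⁻ x in {x | s • affinePoint r x ∈ coneHull P},
        ENNReal.ofReal (r ^ 4 / m.kleinForm r x ^ 2) := by
  rw [chartVolume]
  simp only [h.chart_set_eq hr h2 hs]
  refine setLIntegral_congr_fun (h.measurableSet_chart hr h1 h2 s) fun x hx => ?_
  have hs0 : s ≠ 0 := by rintro rfl; simp at hs
  have hq : 0 < m.kleinForm r x := by
    rw [← form_smul_affinePoint s hs]
    exact h.form_pos hr h2 hx (by simp [affinePoint, hs0, hr.ne'])
  simp only [sqrt_det_metricMatrix m hs hq]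

lemma continuous_form (m : ModelSpace) : Continuous fun X => m.epsSq * m.form X X := by
  unfold form; fun_prop

/-- Slicing at height r with ρ = r produces the density r⁵/(4q²); the factor 4/r converts it to the
Riemannian density r⁴/q². -/
lemma IsEquiangular.chartVolume_eq_volume (hr : 0 < r) (h : m.IsEquiangular r c P)
    (h1 : 0 < m.epsSq * (1 - c)) (h2 : 0 < 1 + 3 * c) {s : ℝ} (hs : s ^ 2 = 1) :
    m.chartVolume r s (m.tetrahedron r P) = ENNReal.ofReal (4 / r) *
      volume {X | s • X ∈ coneHull P ∧ 0 < X 3 ∧ m.epsSq * m.form X X ≤ r ^ 2} := by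
  have hs0 : s ≠ 0 := by rintro rfl; simp at hs
  have hK : MeasurableSet {X : Fin 4 → ℝ | s • X ∈ coneHull P} :=
    (measurable_const_smul s) (measurableSet_coneHull (h.det_ne_zero hr h1 h2))
  have hsl := volume_cone_slice hK (Q := fun X => m.epsSq * m.form X X) (r := r) (ρ := r)
    (fun X hX k hk => by
      rw [Set.mem_ofPred_eq, smul_comm, coneHull_smul_iff hk]; exact hX) m.continuous_form
    (fun k X => by simp only [form, Pi.smul_apply, smul_eq_mul]; ring) hr hr
    (fun X hX hX3 => by
      have h3 := h.form_pos hr h2 hX (by simp [hs0, hX3.ne'])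
      have e : m.form (s • X) (s • X) = m.form X X := by
        simp only [form, Pi.smul_apply, smul_eq_mul]
        linear_combination (X 0 ^ 2 + X 1 ^ 2 + X 2 ^ 2 + m.epsSq * X 3 ^ 2) * hs
      rwa [e] at h3)
  simp only [Set.mem_ofPred_eq, form_affinePoint] at hsl
  rw [hsl, h.chartVolume_eq hr h1 h2 hs, ← lintegral_const_mul' _ _ ENNReal.ofReal_ne_top]
  refine lintegral_congr fun x => ?_
  rw [← ENNReal.ofReal_mul (by positivity)]
  congr 1
  rcases eq_or_ne (m.kleinForm r x) 0 with h0 | h0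
  · simp [h0]
  · field_simp

/-- The volume of a tetrahedron is a multiple of the Lebesgue measure of the solid cone over it. -/
lemma IsEquiangular.riemannianVolume_eq_volume (hr : 0 < r) (h : m.IsEquiangular r c P)
    (h1 : 0 < m.epsSq * (1 - c)) (h2 : 0 < 1 + 3 * c) :
    m.riemannianVolume r (m.tetrahedron r P) = ENNReal.ofReal (4 / r) *
      volume {X | X ∈ coneHull P ∧ m.epsSq * m.form X X ≤ r ^ 2} := by
  rw [riemannianVolume, h.chartVolume_eq_volume hr h1 h2 (by norm_num),
    h.chartVolume_eq_volume hr h1 h2 (by norm_num), ← mul_add]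
  congr 1
  have hP := measurableSet_coneHull (h.det_ne_zero hr h1 h2)
  have hle : MeasurableSet {X | m.epsSq * m.form X X ≤ r ^ 2} :=
    measurableSet_le m.continuous_form.measurable measurable_const
  -- The map X ↦ -X preserves measure and form and moves the contribution of the antipodal chart to
  -- the lower half of the cone. The two halves fill the cone up to the null hyperplane X 3 = 0.
  have hneg : volume {X : Fin 4 → ℝ | (-1 : ℝ) • X ∈ coneHull P ∧ 0 < X 3 ∧
      m.epsSq * m.form X X ≤ r ^ 2} =
      volume {X | X ∈ coneHull P ∧ X 3 < 0 ∧ m.epsSq * m.form X X ≤ r ^ 2} := by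
    rw [← Measure.measure_preimage_neg volume]
    congr 1
    ext X
    simp [form]
  rw [hneg, ← measure_union]
  · refine measure_congr ?_
    have hae : ∀ᵐ X : Fin 4 → ℝ, X 3 ≠ 0 := by
      rw [ae_iff]
      simpa using! Measure.pi_hyperplane (fun _ : Fin 4 => (volume : Measure ℝ)) 3 0
    filter_upwards [hae] with X hX
    simp only [eq_iff_iff]
    change ((1 : ℝ) • X ∈ coneHull P ∧ _ ∧ _) ∨ (_ ∧ _ ∧ _) ↔ _ ∧ _
    rw [one_smul]
    have := lt_or_gt_of_ne hX
    tauto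
  · rw [Set.disjoint_left]
    rintro X ⟨-, hX, -⟩ ⟨-, hX', -⟩
    exact lt_asymm hX hX'
  · exact hP.inter ((measurableSet_lt (measurable_pi_apply 3) measurable_const).inter hle)

/-- The volume of a regular tetrahedron depends only on the mutual inner product of its vertices. -/
lemma IsEquiangular.riemannianVolume_eq (hr : 0 < r) (h : m.IsEquiangular r c P)
    (h1 : 0 < m.epsSq * (1 - c)) (h2 : 0 < 1 + 3 * c) :
    m.riemannianVolume r (m.tetrahedron r P) =
      ENNReal.ofReal (4 * r ^ 3 * √((m.epsSq * (1 - c)) ^ 3 * (1 + 3 * c))) *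
        volume {w : Fin 4 → ℝ | (∀ i, 0 ≤ w i) ∧ equiangularForm c w ≤ 1} := by
  have him : {X | X ∈ coneHull P ∧ m.epsSq * m.form X X ≤ r ^ 2} =
      Matrix.toLin' (Matrix.of P).transpose ''
        {w : Fin 4 → ℝ | (∀ i, 0 ≤ w i) ∧ equiangularForm c w ≤ 1} := by
    have hr2 : 0 < r ^ 2 := by positivity
    have hP : ∀ w : Fin 4 → ℝ, Matrix.toLin' (Matrix.of P).transpose w = ∑ i, w i • P i := by
      intro w
      ext j
      simp [Matrix.toLin'_apply, Matrix.mulVec, dotProduct, Matrix.transpose_apply, mul_comm]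
    ext X
    constructor
    · rintro ⟨⟨w, hw, rfl⟩, hX⟩
      rw [h.form_sum] at hX
      exact ⟨w, ⟨hw, by nlinarith⟩, hP w⟩
    · rintro ⟨w, ⟨hw, hw1⟩, rfl⟩
      refine ⟨⟨w, hw, hP w⟩, ?_⟩
      rw [hP, h.form_sum]
      nlinarith
  rw [h.riemannianVolume_eq_volume hr h1 h2, him, Measure.addHaar_image_linearMap,
    LinearMap.det_toLin', Matrix.det_transpose, h.abs_det hr, ← mul_assoc,
    ← ENNReal.ofReal_mul (by positivity)]
  congr 2
  field_simp

end ModelSpace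

/-! ### Symmetry and decomposition into 24 orthoschemes -/

lemma ae_injective (n : ℕ) : ∀ᵐ w : Fin n → ℝ, Function.Injective w := by
  have h : ∀ i j : Fin n, ∀ᵐ w : Fin n → ℝ, w i = w j → i = j := by
    intro i j
    by_cases hij : i = j
    · simp [hij]
    · let V : Submodule ℝ (Fin n → ℝ) :=
        LinearMap.ker (LinearMap.proj (R := ℝ) (φ := fun _ : Fin n => ℝ) i - LinearMap.proj j)
      have hV : V ≠ ⊤ := by
        intro h
        have : (Pi.single i 1 : Fin n → ℝ) ∈ V := h ▸ Submodule.mem_top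
        simp [V, Ne.symm hij, eq_comm] at this
      rw [ae_iff]
      have := Measure.addHaar_submodule volume V hV
      convert! this using 2
      ext w
      simp [V, hij, sub_eq_zero]
  filter_upwards [ae_all_iff.2 fun i => ae_all_iff.2 (h i)] with w hw i j hij
  exact hw i j hij

/-- A permutation invariant set consists of `n!` copies of its sorted part. -/
lemma volume_eq_factorial_mul_monotone {n : ℕ} {S : Set (Fin n → ℝ)} (hS : MeasurableSet S)
    (hperm : ∀ (σ : Equiv.Perm (Fin n)) (w : Fin n → ℝ), w ∘ σ ∈ S ↔ w ∈ S) :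
    volume S = n.factorial * volume {w | w ∈ S ∧ Monotone w} := by
  have hmono : MeasurableSet {w : Fin n → ℝ | Monotone w} := by
    simp only [Monotone, Set.ofPred_forall]
    exact MeasurableSet.iInter fun i => MeasurableSet.iInter fun j => MeasurableSet.iInter fun _ =>
      measurableSet_le (measurable_pi_apply i) (measurable_pi_apply j)
  have hM : MeasurableSet {w : Fin n → ℝ | w ∈ S ∧ Monotone w} := hS.inter hmono
  let A : Equiv.Perm (Fin n) → Set (Fin n → ℝ) := fun σ =>
    (fun w => w ∘ σ) ⁻¹' {w | w ∈ S ∧ Monotone w}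
  have hmeas : ∀ σ : Equiv.Perm (Fin n), Measurable fun w : Fin n → ℝ => w ∘ σ := fun σ =>
    measurable_pi_iff.2 fun i => measurable_pi_apply _
  have hA : ∀ σ, volume (A σ) = volume {w : Fin n → ℝ | w ∈ S ∧ Monotone w} := by
    intro σ
    have h := volume_measurePreserving_piCongrLeft (fun _ : Fin n => ℝ) σ⁻¹
    have e : (MeasurableEquiv.piCongrLeft (fun _ : Fin n => ℝ) σ⁻¹ : (Fin n → ℝ) → Fin n → ℝ) =
        fun w => w ∘ σ := by
      funext w i
      obtain ⟨j, rfl⟩ := (σ⁻¹ : Equiv.Perm (Fin n)).surjective i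
      rw [MeasurableEquiv.coe_piCongrLeft, Equiv.piCongrLeft_apply_apply]
      simp
    rw [e] at h
    exact h.measure_preimage hM.nullMeasurableSet
  have hU : S = ⋃ σ, A σ := by
    ext w
    simp only [Set.mem_iUnion, A, Set.mem_preimage, Set.mem_ofPred_eq, hperm]
    exact ⟨fun h => ⟨Tuple.sort w, h, Tuple.monotone_sort w⟩, fun ⟨_, h, _⟩ => h⟩
  -- If σ and τ both sort w, then w ∘ σ = w ∘ τ; for distinct σ, τ this forces a repeated
  -- coordinate, a null event.
  have hdis : Pairwise (Function.onFun (AEDisjoint volume) A) := by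
    intro σ τ hστ
    refine measure_mono_null ?_ (ae_iff.1 (ae_injective n))
    rintro w ⟨⟨-, h1⟩, -, h2⟩ hw
    refine hστ (Equiv.ext fun i => hw ?_)
    exact congrFun (Tuple.unique_monotone h1 h2) i
  conv_lhs => rw [hU]
  rw [measure_iUnion₀ hdis fun σ => (hmeas σ hM).nullMeasurableSet, tsum_fintype,
    Finset.sum_congr rfl fun σ _ => hA σ, Finset.sum_const, Finset.card_univ, Fintype.card_perm,
    Fintype.card_fin, nsmul_eq_mul]

/-- The change of coordinates that turns sorted nonnegative vectors into the orthoscheme. -/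
def orthoschemeMatrix : Matrix (Fin 4) (Fin 4) ℝ :=
  !![-3, 0, 0, 3; 1, -4, 0, 3; 1, 2, -6, 3; 1, 2, 6, 3]

lemma det_orthoschemeMatrix : |orthoschemeMatrix.det| = 864 := by
  have : orthoschemeMatrix.det = -864 := by
    simp [orthoschemeMatrix, Matrix.det_succ_row_zero, Fin.sum_univ_succ, Fin.succAbove]
    norm_num
  rw [this]; norm_num

lemma orthoschemeMatrix_mulVec (y : Fin 4 → ℝ) : Matrix.toLin' orthoschemeMatrix y =
    ![-3 * y 0 + 3 * y 3, y 0 - 4 * y 1 + 3 * y 3, y 0 + 2 * y 1 - 6 * y 2 + 3 * y 3,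
      y 0 + 2 * y 1 + 6 * y 2 + 3 * y 3] := by
  ext i
  fin_cases i <;>
    simp [orthoschemeMatrix, Matrix.mulVec, dotProduct, Fin.sum_univ_four] <;> ring

/-- The cone over the standard orthoscheme. -/
def orthoschemeCone : Set (Fin 4 → ℝ) := {y | 0 ≤ y 2 ∧ y 2 ≤ y 1 ∧ y 1 ≤ y 0 ∧ y 0 ≤ y 3}

/-- The quadratic form of equiangular vectors in orthoscheme coordinates. -/
def orthoschemeForm (c : ℝ) (y : Fin 4 → ℝ) : ℝ :=
  36 * (1 + 3 * c) * y 3 ^ 2 + 12 * (1 - c) * (y 0 ^ 2 + 2 * y 1 ^ 2 + 6 * y 2 ^ 2)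

/-- The columns of `orthoschemeMatrix` are orthogonal with squared lengths 12, 24, 72, 36, and only
the last has nonzero coordinate sum. Hence both ∑ w² and (∑ w)² become diagonal. -/
lemma equiangularForm_orthoscheme (c : ℝ) (y : Fin 4 → ℝ) :
    equiangularForm c (Matrix.toLin' orthoschemeMatrix y) = orthoschemeForm c y := by
  rw [orthoschemeMatrix_mulVec]
  simp [equiangularForm, orthoschemeForm, Fin.sum_univ_four]
  ring

lemma monotone_fin_four {w : Fin 4 → ℝ} : Monotone w ↔ w 0 ≤ w 1 ∧ w 1 ≤ w 2 ∧ w 2 ≤ w 3 := by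
  rw [Fin.monotone_iff_le_succ]
  exact ⟨fun h => ⟨h 0, h 1, h 2⟩, fun ⟨h0, h1, h2⟩ i => by fin_cases i <;> assumption⟩

/-- At y 3 = 1 the orthoscheme vertices (0,0,0), (1,0,0), (1,1,0), (1,1,1) go to (3,3,3,3),
(0,4,4,4), (0,0,6,6), (0,0,0,12), the barycentres of a full flag scaled to sum 12. The cone over
them is the set of sorted nonnegative vectors. -/
lemma image_orthoscheme (c : ℝ) :
    {w : Fin 4 → ℝ | w ∈ {w : Fin 4 → ℝ | (∀ i, 0 ≤ w i) ∧ equiangularForm c w ≤ 1} ∧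
      Monotone w} =
      Matrix.toLin' orthoschemeMatrix '' {y | y ∈ orthoschemeCone ∧ orthoschemeForm c y ≤ 1} := by
  ext w
  simp only [Set.mem_image, Set.mem_ofPred_eq]
  constructor
  · rintro ⟨⟨hw, hQ⟩, hm⟩
    rw [monotone_fin_four] at hm
    obtain ⟨h0, h1, h2⟩ := hm
    have hw0 := hw 0
    -- The inverse of `orthoschemeMatrix`, expressed through the successive gaps of w.
    refine ⟨![(w 3 - w 2) / 12 + (w 2 - w 1) / 6 + (w 1 - w 0) / 4, (w 3 - w 2) / 12 +
      (w 2 - w 1) / 6, (w 3 - w 2) / 12, (w 3 - w 2) / 12 + (w 2 - w 1) / 6 + (w 1 - w 0) / 4 +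
      w 0 / 3], ?_⟩
    have e : Matrix.toLin' orthoschemeMatrix ![(w 3 - w 2) / 12 + (w 2 - w 1) / 6 + (w 1 - w 0) / 4,
        (w 3 - w 2) / 12 + (w 2 - w 1) / 6, (w 3 - w 2) / 12, (w 3 - w 2) / 12 + (w 2 - w 1) / 6 +
        (w 1 - w 0) / 4 + w 0 / 3] = w := by
      rw [orthoschemeMatrix_mulVec]
      ext i
      fin_cases i <;> simp <;> ring
    refine ⟨⟨?_, ?_⟩, e⟩
    · simp only [orthoschemeCone, Set.mem_ofPred_eq]
      simp
      exact ⟨by linarith, by linarith, by linarith, by linarith⟩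
    · rwa [← equiangularForm_orthoscheme, e]
  · rintro ⟨y, ⟨⟨h0, h1, h2, h3⟩, hQ⟩, rfl⟩
    rw [equiangularForm_orthoscheme]
    have h := orthoschemeMatrix_mulVec y
    refine ⟨⟨fun i => ?_, hQ⟩, ?_⟩
    · rw [h]; fin_cases i <;> simp <;> linarith
    · rw [h, monotone_fin_four]
      simp
      refine ⟨by linarith, by linarith, by linarith⟩

lemma orthoschemeForm_pos {c : ℝ} (hc : 0 < 1 + 3 * c) {y : Fin 4 → ℝ} (hy : y ∈ orthoschemeCone)
    (hy3 : 0 < y 3) : 0 < orthoschemeForm c y := by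
  obtain ⟨h0, h1, h2, h3⟩ := hy
  have h := orthoschemeMatrix_mulVec y
  rw [← equiangularForm_orthoscheme]
  refine equiangularForm_pos hc (fun i => ?_) fun h0 => ?_
  · rw [h]; fin_cases i <;> simp <;> linarith
  · rw [h] at h0
    have := congrFun h0 3
    simp at this
    linarith

/-- The constant 24 counts the orderings and 864 is the Jacobian of `orthoschemeMatrix`; the
integral is the slice y 3 = 1 of the orthoscheme cone. -/
lemma volume_equiangular {c : ℝ} (hc : 0 < 1 + 3 * c) :
    volume {w : Fin 4 → ℝ | (∀ i, 0 ≤ w i) ∧ equiangularForm c w ≤ 1} =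
      ENNReal.ofReal (24 * 864) * ∫⁻ x in {x : Fin 3 → ℝ | 0 ≤ x 2 ∧ x 2 ≤ x 1 ∧ x 1 ≤ x 0 ∧ x 0 ≤ 1},
        ENNReal.ofReal (1 / (4 * (36 * (1 + 3 * c) +
          12 * (1 - c) * (x 0 ^ 2 + 2 * x 1 ^ 2 + 6 * x 2 ^ 2)) ^ 2)) := by
  have hcont : Continuous (equiangularForm c) := by unfold equiangularForm; fun_prop
  have hcont' : Continuous (orthoschemeForm c) := by unfold orthoschemeForm; fun_prop
  have hK : MeasurableSet orthoschemeCone := by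
    have := fun i : Fin 4 => measurable_pi_apply (X := fun _ => ℝ) i
    exact (measurableSet_le measurable_const (this 2)).inter ((measurableSet_le (this 2) (this 1)).inter
      ((measurableSet_le (this 1) (this 0)).inter (measurableSet_le (this 0) (this 3))))
  have hS : MeasurableSet {w : Fin 4 → ℝ | (∀ i, 0 ≤ w i) ∧ equiangularForm c w ≤ 1} := by
    refine MeasurableSet.inter (s₁ := {w : Fin 4 → ℝ | ∀ i, 0 ≤ w i}) ?_
      (measurableSet_le hcont.measurable measurable_const)
    rw [Set.ofPred_forall]
    exact MeasurableSet.iInter fun i => measurableSet_le measurable_const (measurable_pi_apply i)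
  rw [volume_eq_factorial_mul_monotone hS, image_orthoscheme, Measure.addHaar_image_linearMap,
    LinearMap.det_toLin', det_orthoschemeMatrix, ← mul_assoc]
  · congr 1
    · rw [ENNReal.ofReal_mul (by norm_num)]
      simp [Nat.factorial]
    · have hsl := volume_cone_slice hK (Q := orthoschemeForm c) (r := 1) (ρ := 1)
        (fun X hX k hk => by
          obtain ⟨h0, h1, h2, h3⟩ := hX
          exact ⟨mul_nonneg hk.le h0, mul_le_mul_of_nonneg_left h1 hk.le,
            mul_le_mul_of_nonneg_left h2 hk.le, mul_le_mul_of_nonneg_left h3 hk.le⟩) hcont'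
        (fun k X => by simp only [orthoschemeForm, Pi.smul_apply, smul_eq_mul]; ring)
        one_pos one_pos (fun X hX hX3 => orthoschemeForm_pos hc hX hX3)
      have e : ∀ x : Fin 3 → ℝ, orthoschemeForm c (affinePoint 1 x) = 36 * (1 + 3 * c) +
          12 * (1 - c) * (x 0 ^ 2 + 2 * x 1 ^ 2 + 6 * x 2 ^ 2) := by
        intro x; simp [orthoschemeForm, affinePoint]
      have e2 : {x : Fin 3 → ℝ | affinePoint 1 x ∈ orthoschemeCone} =
          {x : Fin 3 → ℝ | 0 ≤ x 2 ∧ x 2 ≤ x 1 ∧ x 1 ≤ x 0 ∧ x 0 ≤ 1} := by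
        ext x; simp [orthoschemeCone, affinePoint]
      simp only [e, e2, one_pow, one_mul] at hsl
      rw [← hsl]
      refine measure_congr ?_
      have hae : ∀ᵐ X : Fin 4 → ℝ, X 3 ≠ 0 := by
        rw [ae_iff]
        simpa using! Measure.pi_hyperplane (fun _ : Fin 4 => (volume : Measure ℝ)) 3 0
      filter_upwards [hae] with X hX
      simp only [eq_iff_iff]
      change _ ∧ _ ↔ _ ∧ _ ∧ _
      refine and_congr_right fun hXK => ?_
      have : 0 < X 3 := lt_of_le_of_ne
        (hXK.1.trans (hXK.2.1.trans (hXK.2.2.1.trans hXK.2.2.2))) hX.symm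
      exact (and_iff_right this).symm
  · intro σ w
    simp only [Set.mem_ofPred_eq, equiangularForm, Function.comp_apply]
    rw [Equiv.sum_comp σ w, Equiv.sum_comp σ (fun i => w i ^ 2)]
    refine and_congr_left' ⟨fun h i => ?_, fun h i => h _⟩
    simpa using h (σ⁻¹ i)

/-! ### Reduction of the orthoscheme integral to a double integral -/

lemma lintegral_Icc_zero_eq {u : ℝ} (hu : 0 ≤ u) (g : ℝ → ℝ≥0∞) :
    ∫⁻ v in Set.Icc 0 u, g v = ENNReal.ofReal u * ∫⁻ s in Set.Icc (0 : ℝ) 1, g (u * s) := by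
  rcases hu.eq_or_lt with rfl | hu
  · simp
  · have h := lintegral_image_eq_lintegral_abs_deriv_mul (s := Set.Icc (0 : ℝ) 1)
      (f := fun s => u * s) (f' := fun _ => u) measurableSet_Icc
      (fun x _ => by simpa using ((hasDerivAt_id x).const_mul u).hasDerivWithinAt)
      (fun x _ y _ h => mul_left_cancel₀ hu.ne' h) g
    rw [Set.image_mul_left_Icc' hu, mul_zero, mul_one] at h
    rw [h, abs_of_pos hu, lintegral_const_mul' _ _ ENNReal.ofReal_ne_top]

lemma lintegral_fin_three {f : (Fin 3 → ℝ) → ℝ≥0∞} (hf : Measurable f) :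
    ∫⁻ x, f x = ∫⁻ q : ℝ, ∫⁻ u : ℝ, ∫⁻ v : ℝ, f ![q, u, v] := by
  have h := (volume_preserving_piFinSuccAbove (fun _ : Fin 3 => ℝ) 0).symm
  rw [← h.lintegral_comp_emb (MeasurableEquiv.measurableEmbedding _), Measure.volume_eq_prod,
    lintegral_prod (fun p => f ((MeasurableEquiv.piFinSuccAbove (fun _ : Fin 3 => ℝ) 0).symm p))
      (hf.comp (MeasurableEquiv.measurable _)).aemeasurable]
  refine lintegral_congr fun q => ?_
  have h2 := (volume_preserving_finTwoArrow ℝ).symm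
  rw [← h2.lintegral_comp_emb (MeasurableEquiv.measurableEmbedding _), Measure.volume_eq_prod,
    lintegral_prod]
  · refine lintegral_congr fun u => lintegral_congr fun v => ?_
    congr 1
    ext i
    fin_cases i <;> rfl
  · refine Measurable.aemeasurable ?_
    exact (hf.comp (MeasurableEquiv.measurable _)).comp
      (measurable_const.prodMk (MeasurableEquiv.measurable _))

/-- Integration over the orthoscheme in coordinates that turn it into a cube. -/
lemma lintegral_orthoscheme {g : ℝ → ℝ → ℝ → ℝ≥0∞}
    (hg : Measurable fun p : ℝ × ℝ × ℝ => g p.1 p.2.1 p.2.2) :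
    ∫⁻ x in {x : Fin 3 → ℝ | 0 ≤ x 2 ∧ x 2 ≤ x 1 ∧ x 1 ≤ x 0 ∧ x 0 ≤ 1}, g (x 0) (x 1) (x 2) =
      ∫⁻ q in Set.Icc (0 : ℝ) 1, ENNReal.ofReal (q ^ 2) * ∫⁻ s in Set.Icc (0 : ℝ) 1,
        ∫⁻ u in Set.Icc (0 : ℝ) 1, ENNReal.ofReal u * g q (q * u) (q * u * s) := by
  have hx := fun i : Fin 3 => measurable_pi_apply (X := fun _ => ℝ) i
  have hS : MeasurableSet {x : Fin 3 → ℝ | 0 ≤ x 2 ∧ x 2 ≤ x 1 ∧ x 1 ≤ x 0 ∧ x 0 ≤ 1} :=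
    (measurableSet_le measurable_const (hx 2)).inter ((measurableSet_le (hx 2) (hx 1)).inter
      ((measurableSet_le (hx 1) (hx 0)).inter (measurableSet_le (hx 0) measurable_const)))
  have hg' : Measurable fun x : Fin 3 → ℝ => g (x 0) (x 1) (x 2) :=
    hg.comp ((hx 0).prodMk ((hx 1).prodMk (hx 2)))
  rw [← lintegral_indicator hS, lintegral_fin_three (hg'.indicator hS),
    ← lintegral_indicator measurableSet_Icc]
  refine lintegral_congr fun q => ?_
  by_cases hq : q ∈ Set.Icc (0 : ℝ) 1
  swap
  · rw [Set.indicator_of_notMem hq]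
    have : ∀ u v : ℝ, ({x : Fin 3 → ℝ | 0 ≤ x 2 ∧ x 2 ≤ x 1 ∧ x 1 ≤ x 0 ∧ x 0 ≤ 1}).indicator
        (fun x => g (x 0) (x 1) (x 2)) ![q, u, v] = 0 := by
      intro u v
      refine Set.indicator_of_notMem (fun h => hq ?_) _
      simp at h
      exact ⟨h.1.trans (h.2.1.trans h.2.2.1), h.2.2.2⟩
    simp [this]
  rw [Set.indicator_of_mem hq]
  have h1 : ∀ u : ℝ, ∫⁻ v : ℝ, ({x : Fin 3 → ℝ | 0 ≤ x 2 ∧ x 2 ≤ x 1 ∧ x 1 ≤ x 0 ∧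
      x 0 ≤ 1}).indicator (fun x => g (x 0) (x 1) (x 2)) ![q, u, v] =
      (Set.Icc 0 q).indicator (fun u => ENNReal.ofReal u *
        ∫⁻ s in Set.Icc (0 : ℝ) 1, g q u (u * s)) u := by
    intro u
    by_cases hu : u ∈ Set.Icc 0 q
    · rw [Set.indicator_of_mem hu, ← lintegral_Icc_zero_eq hu.1 (g q u),
        ← lintegral_indicator measurableSet_Icc]
      refine lintegral_congr fun v => ?_
      by_cases hv : v ∈ Set.Icc 0 u
      · rw [Set.indicator_of_mem hv, Set.indicator_of_mem]
        · simp
        · simp; exact ⟨hv.1, hv.2, hu.2, hq.2⟩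
      · rw [Set.indicator_of_notMem hv, Set.indicator_of_notMem]
        intro h
        simp at h
        exact hv ⟨h.1, h.2.1⟩
    · rw [Set.indicator_of_notMem hu]
      have : ∀ v : ℝ, ({x : Fin 3 → ℝ | 0 ≤ x 2 ∧ x 2 ≤ x 1 ∧ x 1 ≤ x 0 ∧ x 0 ≤ 1}).indicator
          (fun x => g (x 0) (x 1) (x 2)) ![q, u, v] = 0 := by
        intro v
        refine Set.indicator_of_notMem (fun h => hu ?_) _
        simp at h
        exact ⟨h.1.trans h.2.1, h.2.2.1⟩
      simp [this]
  simp_rw [h1]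
  -- Rescaling the middle variable contributes the second factor q; the exchange puts u innermost,
  -- where the integral is elementary.
  rw [lintegral_indicator measurableSet_Icc, lintegral_Icc_zero_eq hq.1, lintegral_lintegral_swap]
  · rw [sq, ENNReal.ofReal_mul hq.1, mul_assoc]
    congr 1
    rw [← lintegral_const_mul' _ _ ENNReal.ofReal_ne_top]
    refine lintegral_congr fun u => ?_
    rw [ENNReal.ofReal_mul hq.1, mul_assoc, ← lintegral_const_mul' (ENNReal.ofReal u) _
      ENNReal.ofReal_ne_top]
  · refine Measurable.aemeasurable ?_
    have : Measurable fun p : ℝ × ℝ => (q, q * p.2, q * p.2 * p.1) := by fun_prop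
    exact (measurable_snd.ennreal_ofReal).mul (hg.comp this)

lemma lintegral_Icc_ofReal_of_hasDerivAt {F f : ℝ → ℝ} {b : ℝ} (hb : 0 ≤ b)
    (hF : ∀ x ∈ Set.Icc 0 b, HasDerivAt F (f x) x) (hf : ContinuousOn f (Set.Icc 0 b))
    (h0 : ∀ x ∈ Set.Icc 0 b, 0 ≤ f x) :
    ∫⁻ x in Set.Icc 0 b, ENNReal.ofReal (f x) = ENNReal.ofReal (F b - F 0) := by
  rw [← ofReal_integral_eq_lintegral_ofReal (hf.integrableOn_compact isCompact_Icc)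
    (ae_restrict_of_forall_mem measurableSet_Icc h0), integral_Icc_eq_integral_Ioc,
    ← intervalIntegral.integral_of_le hb]
  rw [intervalIntegral.integral_eq_sub_of_hasDerivAt]
  · rwa [Set.uIcc_of_le hb]
  · exact ContinuousOn.intervalIntegrable (by rwa [Set.uIcc_of_le hb])

/-- The weight u makes the integrand exact, with primitive u²/(8A(A + Ku²)) vanishing at 0. -/
lemma lintegral_mul_inv_sq {A K : ℝ} (hA : 0 < A) (hK : 0 < A + K) :
    ∫⁻ u in Set.Icc (0 : ℝ) 1, ENNReal.ofReal u * ENNReal.ofReal (1 / (4 * (A + K * u ^ 2) ^ 2)) =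
      ENNReal.ofReal (1 / (8 * A * (A + K))) := by
  have hpos : ∀ u ∈ Set.Icc (0 : ℝ) 1, 0 < A + K * u ^ 2 := by
    intro u hu
    have h1 : u ^ 2 ≤ 1 := by nlinarith [hu.1, hu.2]
    have h2 := sq_nonneg u
    have : A + K * u ^ 2 = (1 - u ^ 2) * A + u ^ 2 * (A + K) := by ring
    rw [this]
    rcases h2.eq_or_lt with h | h
    · rw [← h]; linarith
    · nlinarith
  have h := lintegral_Icc_ofReal_of_hasDerivAt (F := fun u => u ^ 2 / (8 * A * (A + K * u ^ 2)))
    (f := fun u => u * (1 / (4 * (A + K * u ^ 2) ^ 2))) zero_le_one ?_ ?_ ?_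
  · simp only [one_pow, mul_one, ne_eq, OfNat.ofNat_ne_zero, not_false_eq_true, zero_pow,
      zero_div, sub_zero] at h
    rw [← h]
    refine setLIntegral_congr_fun measurableSet_Icc fun u hu => ?_
    simp only [ENNReal.ofReal_mul hu.1]
  · intro u hu
    have hp := hpos u hu
    refine (((hasDerivAt_id u).pow 2).div (((((hasDerivAt_id u).pow 2).const_mul K).const_add
      A).const_mul (8 * A)) (by simp; exact ⟨hA.ne', hp.ne'⟩)).congr_deriv ?_
    simp only [id, Pi.pow_apply]
    have := hp.ne'
    field_simp
    ring
  · refine continuousOn_id.mul (ContinuousOn.div continuousOn_const (by fun_prop) fun u hu => ?_)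
    have := hpos u hu
    positivity
  · intro u hu
    have := hpos u hu
    have := hu.1
    positivity

lemma volume_equiangular_eq_lintegral {c : ℝ} (hc : 0 < 1 + 3 * c) :
    volume {w : Fin 4 → ℝ | (∀ i, 0 ≤ w i) ∧ equiangularForm c w ≤ 1} =
      ENNReal.ofReal (24 * 864) * ∫⁻ q in Set.Icc (0 : ℝ) 1, ∫⁻ s in Set.Icc (0 : ℝ) 1,
        ENNReal.ofReal (q ^ 2 / (8 * (36 * (1 + 3 * c) + 12 * (1 - c) * q ^ 2) *
          (36 * (1 + 3 * c) + 12 * (1 - c) * q ^ 2 * (3 + 6 * s ^ 2)))) := by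
  -- The bound 9 = 1 + 2 + 6 is the maximum of x₀² + 2x₁² + 6x₂² on the orthoscheme. The expression
  -- is affine in x, with values 36(1 + 3c) at 0 and 144 at 9.
  have hpos : ∀ x : ℝ, 0 ≤ x → x ≤ 9 → 0 < 36 * (1 + 3 * c) + 12 * (1 - c) * x := by
    intro x h0 h9
    have : 36 * (1 + 3 * c) + 12 * (1 - c) * x = 12 * (1 + 3 * c) * ((9 - x) / 3) + 16 * x := by
      ring
    rw [this]
    rcases h0.eq_or_lt with rfl | h
    · linarith
    · have : 0 ≤ 12 * (1 + 3 * c) * ((9 - x) / 3) := by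
        refine mul_nonneg (by linarith) (by linarith)
      linarith
  rw [volume_equiangular hc]
  congr 1
  rw [lintegral_orthoscheme (g := fun a b d => ENNReal.ofReal (1 / (4 * (36 * (1 + 3 * c) +
    12 * (1 - c) * (a ^ 2 + 2 * b ^ 2 + 6 * d ^ 2)) ^ 2))) (by fun_prop)]
  refine setLIntegral_congr_fun measurableSet_Icc fun q hq => ?_
  have hq2 : q ^ 2 ≤ 1 := by nlinarith [hq.1, hq.2]
  rw [← lintegral_const_mul' _ _ ENNReal.ofReal_ne_top]
  refine setLIntegral_congr_fun measurableSet_Icc fun s hs => ?_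
  have hs2 : s ^ 2 ≤ 1 := by nlinarith [hs.1, hs.2]
  have h1 := hpos (q ^ 2) (sq_nonneg q) (by linarith)
  have h2 := hpos (q ^ 2 * (3 + 6 * s ^ 2)) (by positivity)
    (by nlinarith [sq_nonneg q, sq_nonneg s])
  have h3 := lintegral_mul_inv_sq (A := 36 * (1 + 3 * c) + 12 * (1 - c) * q ^ 2)
    (K := 12 * (1 - c) * q ^ 2 * (2 + 6 * s ^ 2)) h1 (by
      convert h2 using 1; ring)
  have e : ∀ u : ℝ, 36 * (1 + 3 * c) + 12 * (1 - c) * (q ^ 2 + 2 * (q * u) ^ 2 +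
      6 * (q * u * s) ^ 2) = 36 * (1 + 3 * c) + 12 * (1 - c) * q ^ 2 +
      12 * (1 - c) * q ^ 2 * (2 + 6 * s ^ 2) * u ^ 2 := by intro u; ring
  simp only [e]
  rw [h3, ← ENNReal.ofReal_mul (sq_nonneg q)]
  congr 1
  rw [mul_one_div]
  congr 2
  ring

/-! ### Substitution to the half-edge tangent -/

namespace ModelSpace

variable {m : ModelSpace} {r T : ℝ}

lemma bounds_of_le (hT1 : 0 < 1 + m.epsSq * T ^ 2) (hT2 : 0 < 2 - m.epsSq * T ^ 2) {t : ℝ}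
    (ht : t ∈ Set.Icc 0 T) : 0 < 1 + m.epsSq * t ^ 2 ∧ 0 < 2 - m.epsSq * t ^ 2 := by
  have : t ^ 2 ≤ T ^ 2 := pow_le_pow_left₀ ht.1 ht.2 2
  have h := sq_nonneg t
  rcases m.epsSq_eq_or with h' | h' <;> rw [h'] at hT1 hT2 ⊢ <;> constructor <;> nlinarith

/-- The integrand of the volume formula. -/
noncomputable def volumeIntegrand (m : ModelSpace) (t : ℝ) : ℝ :=
  t * m.atn t / ((3 - m.epsSq * t ^ 2) * √(2 - m.epsSq * t ^ 2))

lemma atn_nonneg (hT1 : 0 < 1 + m.epsSq * T ^ 2) (hT : 0 ≤ T) : 0 ≤ m.atn T := by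
  cases m
  · exact Real.arctan_nonneg.2 hT
  · exact Real.artanh_nonneg hT

lemma volumeIntegrand_nonneg (hT1 : 0 < 1 + m.epsSq * T ^ 2) (hT2 : 0 < 2 - m.epsSq * T ^ 2)
    {t : ℝ} (ht : t ∈ Set.Icc 0 T) : 0 ≤ m.volumeIntegrand t := by
  obtain ⟨h1, h2⟩ := bounds_of_le hT1 hT2 ht
  have h3 := atn_nonneg h1 ht.1
  have h4 : 0 < 3 - m.epsSq * t ^ 2 := by linarith
  have := ht.1
  unfold volumeIntegrand
  positivity

lemma continuousOn_volumeIntegrand (hT1 : 0 < 1 + m.epsSq * T ^ 2)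
    (hT2 : 0 < 2 - m.epsSq * T ^ 2) : ContinuousOn m.volumeIntegrand (Set.Icc 0 T) := by
  refine ContinuousOn.div (continuousOn_id.mul fun t ht => ?_) (by fun_prop) fun t ht => ?_
  · exact (m.hasDerivAt_atn (bounds_of_le hT1 hT2 ht).1).continuousAt.continuousWithinAt
  · obtain ⟨h1, h2⟩ := bounds_of_le hT1 hT2 ht
    have h4 : 0 < 3 - m.epsSq * t ^ 2 := by linarith
    have := Real.sqrt_pos.2 h2
    positivity

/-- The identity t · atn t = ∫₀¹ t²/(1 + ηt²s²) ds undoes the last integration, so that the formula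
can be compared with the double integral pointwise in (q, s). -/
lemma ofReal_volumeIntegrand (hT1 : 0 < 1 + m.epsSq * T ^ 2) (hT2 : 0 < 2 - m.epsSq * T ^ 2)
    {t : ℝ} (ht : t ∈ Set.Icc 0 T) :
    ENNReal.ofReal (m.volumeIntegrand t) = ∫⁻ s in Set.Icc (0 : ℝ) 1,
      ENNReal.ofReal (t ^ 2 / ((1 + m.epsSq * (t * s) ^ 2) *
        ((3 - m.epsSq * t ^ 2) * √(2 - m.epsSq * t ^ 2)))) := by
  obtain ⟨h1, h2⟩ := bounds_of_le hT1 hT2 ht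
  have h4 : 0 < 3 - m.epsSq * t ^ 2 := by linarith
  have h5 := Real.sqrt_pos.2 h2
  have hs : ∀ s ∈ Set.Icc (0 : ℝ) 1, 0 < 1 + m.epsSq * (t * s) ^ 2 := fun s hs =>
    (bounds_of_le h1 h2 ⟨mul_nonneg ht.1 hs.1, mul_le_of_le_one_right ht.1 hs.2⟩).1
  rw [lintegral_Icc_ofReal_of_hasDerivAt (F := fun s => t * m.atn (t * s) /
    ((3 - m.epsSq * t ^ 2) * √(2 - m.epsSq * t ^ 2))) zero_le_one]
  · simp [atn_zero, volumeIntegrand]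
  · intro s hs'
    refine ((((m.hasDerivAt_atn (hs s hs')).comp s
      ((hasDerivAt_id s).const_mul t)).const_mul t).div_const _).congr_deriv ?_
    have := (hs s hs').ne'
    simp only [mul_one, one_div]
    generalize 1 + m.epsSq * (t * s) ^ 2 = Y at *
    field_simp
  · refine ContinuousOn.div continuousOn_const (by fun_prop) fun s hs' => ?_
    have := hs s hs'
    positivity
  · intro s hs'
    have := hs s hs'
    positivity

lemma radicand_pos (hT2 : 0 < 2 - m.epsSq * T ^ 2) {q : ℝ} (hq : q ∈ Set.Icc (0 : ℝ) 1) :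
    0 < 2 - m.epsSq * T ^ 2 + m.epsSq * T ^ 2 * q ^ 2 := by
  have h1 : q ^ 2 ≤ 1 := by nlinarith [hq.1, hq.2]
  have : 2 - m.epsSq * T ^ 2 + m.epsSq * T ^ 2 * q ^ 2 =
    (2 - m.epsSq * T ^ 2) * (1 - q ^ 2) + 2 * q ^ 2 := by ring
  rw [this]
  rcases (sq_nonneg q).eq_or_lt with h | h
  · rw [← h]; linarith
  · have := mul_nonneg hT2.le (sub_nonneg.2 h1)
    linarith

/-- The substitution that turns the distance from the centre into the half-edge tangent. -/
lemma lintegral_substitution (hT : 0 < T) (hT2 : 0 < 2 - m.epsSq * T ^ 2) (g : ℝ → ℝ≥0∞) :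
    ∫⁻ t in Set.Icc 0 T, g t = ∫⁻ q in Set.Icc (0 : ℝ) 1,
      ENNReal.ofReal (√2 * T * (2 - m.epsSq * T ^ 2) /
        √(2 - m.epsSq * T ^ 2 + m.epsSq * T ^ 2 * q ^ 2) ^ 3) *
      g (√2 * T * q / √(2 - m.epsSq * T ^ 2 + m.epsSq * T ^ 2 * q ^ 2)) := by
  have hD : ∀ q ∈ Set.Icc (0 : ℝ) 1, 0 < 2 - m.epsSq * T ^ 2 + m.epsSq * T ^ 2 * q ^ 2 :=
    fun q hq => radicand_pos hT2 hq
  set φ : ℝ → ℝ := fun q => √2 * T * q / √(2 - m.epsSq * T ^ 2 + m.epsSq * T ^ 2 * q ^ 2) with hφ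
  have hd : ∀ q ∈ Set.Icc (0 : ℝ) 1, HasDerivAt φ (√2 * T * (2 - m.epsSq * T ^ 2) /
      √(2 - m.epsSq * T ^ 2 + m.epsSq * T ^ 2 * q ^ 2) ^ 3) q := by
    intro q hq
    have h := hD q hq
    have h' := Real.sqrt_pos.2 h
    have hi : HasDerivAt (fun q : ℝ => 2 - m.epsSq * T ^ 2 + m.epsSq * T ^ 2 * q ^ 2)
        (m.epsSq * T ^ 2 * (2 * q)) q := by
      simpa using (((hasDerivAt_id q).pow 2).const_mul (m.epsSq * T ^ 2)).const_add
        (2 - m.epsSq * T ^ 2)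
    refine (((hasDerivAt_id q).const_mul (√2 * T)).div (hi.sqrt h.ne') h'.ne').congr_deriv ?_
    have hsq := Real.sq_sqrt h.le
    simp only [id]
    generalize √(2 - m.epsSq * T ^ 2 + m.epsSq * T ^ 2 * q ^ 2) = d at *
    field_simp
    linear_combination hsq
  have hpos : ∀ q ∈ Set.Icc (0 : ℝ) 1, 0 < √2 * T * (2 - m.epsSq * T ^ 2) /
      √(2 - m.epsSq * T ^ 2 + m.epsSq * T ^ 2 * q ^ 2) ^ 3 := by
    intro q hq
    have := Real.sqrt_pos.2 (hD q hq)
    positivity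
  have hcont : ContinuousOn φ (Set.Icc 0 1) := fun q hq =>
    (hd q hq).continuousAt.continuousWithinAt
  have hmono : StrictMonoOn φ (Set.Icc 0 1) := by
    refine strictMonoOn_of_deriv_pos (convex_Icc 0 1) hcont fun q hq => ?_
    rw [interior_Icc] at hq
    rw [(hd q (Set.Ioo_subset_Icc_self hq)).deriv]
    exact hpos q (Set.Ioo_subset_Icc_self hq)
  have h0 : φ 0 = 0 := by simp [hφ]
  have h1 : φ 1 = T := by
    simp only [hφ]
    rw [show 2 - m.epsSq * T ^ 2 + m.epsSq * T ^ 2 * 1 ^ 2 = 2 by ring]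
    field_simp
  have himage : φ '' Set.Icc 0 1 = Set.Icc 0 T := by
    rw [show Set.Icc 0 T = Set.Icc (φ 0) (φ 1) by rw [h0, h1]]
    refine Set.Subset.antisymm ?_ (intermediate_value_Icc zero_le_one hcont)
    rintro _ ⟨q, hq, rfl⟩
    exact ⟨hmono.monotoneOn (Set.left_mem_Icc.2 zero_le_one) hq hq.1,
      hmono.monotoneOn hq (Set.right_mem_Icc.2 zero_le_one) hq.2⟩
  rw [← himage, lintegral_image_eq_lintegral_abs_deriv_mul measurableSet_Icc
    (fun q hq => (hd q hq).hasDerivWithinAt) hmono.injOn]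
  refine setLIntegral_congr_fun measurableSet_Icc fun q hq => ?_
  simp only [abs_of_pos (hpos q hq)]
  rfl

/-- It is applied with E = 1 + ηT², δ² = 2 - ηT², d² = δ² + ηT²q² and t = √2 T q/d. Then Y = d²(1 +
ηt²s²), Z = d²(3 - ηt²), and √2 δ/d = √(2 - ηt²). On the left, 4T³δ/E² comes from the Gram
determinant. -/
lemma density_identity (r T q : ℝ) {E Y Z d δ : ℝ} (hE : 0 < E) (hY : 0 < Y) (hZ : 0 < Z)
    (hd : 0 < d) (hδ : 0 < δ) :
    4 * r ^ 3 * (4 * T ^ 3 * δ / E ^ 2) * (24 * 864) *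
      (q ^ 2 / (8 * (24 * Z / E) * (72 * Y / E))) =
    12 * r ^ 3 * (√2 * T * δ ^ 2 / d ^ 3) *
      ((√2 * T * q / d) ^ 2 / (Y / d ^ 2 * (Z / d ^ 2 * (√2 * δ / d)))) := by
  rw [div_pow, mul_pow, mul_pow, Real.sq_sqrt (by norm_num : (0 : ℝ) ≤ 2)]
  field_simp
  ring

/-- The expression is affine in k = q² + 2q²s² ∈ [0, 3], with the positive values 2 - ηT² at k = 0
and 2(1 + ηT²) at k = 3. -/
lemma denominator_pos (hT1 : 0 < 1 + m.epsSq * T ^ 2) (hT2 : 0 < 2 - m.epsSq * T ^ 2) {q s : ℝ}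
    (hq : q ∈ Set.Icc (0 : ℝ) 1) (hs : s ∈ Set.Icc (0 : ℝ) 1) :
    0 < 2 - m.epsSq * T ^ 2 + m.epsSq * T ^ 2 * q ^ 2 +
      2 * (m.epsSq * T ^ 2) * q ^ 2 * s ^ 2 := by
  have hk1 : q ^ 2 ≤ 1 := by nlinarith [hq.1, hq.2]
  have hk2 : q ^ 2 * s ^ 2 ≤ 1 := by
    have : s ^ 2 ≤ 1 := by nlinarith [hs.1, hs.2]
    nlinarith [sq_nonneg q, sq_nonneg s]
  have hk3 : 0 ≤ q ^ 2 * s ^ 2 := by positivity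
  have hk4 := sq_nonneg q
  obtain ⟨k, hk⟩ : ∃ k, k = q ^ 2 + 2 * (q ^ 2 * s ^ 2) := ⟨_, rfl⟩
  have : 2 - m.epsSq * T ^ 2 + m.epsSq * T ^ 2 * q ^ 2 + 2 * (m.epsSq * T ^ 2) * q ^ 2 * s ^ 2 =
      (2 - m.epsSq * T ^ 2) * ((3 - k) / 3) + (2 * (1 + m.epsSq * T ^ 2)) * (k / 3) := by
    rw [hk]; ring
  rw [this]
  have hk0 : 0 ≤ k := by linarith
  rcases (show k ≤ 3 by linarith).eq_or_lt with h | h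
  · rw [h]; linarith
  · have : 0 < (3 - k) / 3 := by linarith
    positivity

lemma density_substitution (hT : 0 < T) (hT1 : 0 < 1 + m.epsSq * T ^ 2)
    (hT2 : 0 < 2 - m.epsSq * T ^ 2) {q s : ℝ} (hq : q ∈ Set.Icc (0 : ℝ) 1)
    (hs : s ∈ Set.Icc (0 : ℝ) 1) :
    4 * r ^ 3 * √((2 * T ^ 2 / (1 + m.epsSq * T ^ 2)) ^ 3 *
      (2 * (2 - m.epsSq * T ^ 2) / (1 + m.epsSq * T ^ 2))) * (24 * 864) *
      (q ^ 2 / (8 * (36 * (2 * (2 - m.epsSq * T ^ 2) / (1 + m.epsSq * T ^ 2)) +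
        12 * (2 * (m.epsSq * T ^ 2) / (1 + m.epsSq * T ^ 2)) * q ^ 2) *
        (36 * (2 * (2 - m.epsSq * T ^ 2) / (1 + m.epsSq * T ^ 2)) +
          12 * (2 * (m.epsSq * T ^ 2) / (1 + m.epsSq * T ^ 2)) * q ^ 2 * (3 + 6 * s ^ 2)))) =
    12 * r ^ 3 * (√2 * T * (2 - m.epsSq * T ^ 2) /
        √(2 - m.epsSq * T ^ 2 + m.epsSq * T ^ 2 * q ^ 2) ^ 3) *
      ((√2 * T * q / √(2 - m.epsSq * T ^ 2 + m.epsSq * T ^ 2 * q ^ 2)) ^ 2 /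
        ((1 + m.epsSq * (√2 * T * q / √(2 - m.epsSq * T ^ 2 + m.epsSq * T ^ 2 * q ^ 2) * s) ^ 2) *
          ((3 - m.epsSq * (√2 * T * q / √(2 - m.epsSq * T ^ 2 + m.epsSq * T ^ 2 * q ^ 2)) ^ 2) *
            √(2 - m.epsSq *
              (√2 * T * q / √(2 - m.epsSq * T ^ 2 + m.epsSq * T ^ 2 * q ^ 2)) ^ 2)))) := by
  have hD := radicand_pos hT2 hq
  obtain ⟨d, hd, hd2⟩ : ∃ d : ℝ, 0 < d ∧ 2 - m.epsSq * T ^ 2 + m.epsSq * T ^ 2 * q ^ 2 = d ^ 2 :=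
    ⟨_, Real.sqrt_pos.2 hD, (Real.sq_sqrt hD.le).symm⟩
  obtain ⟨δ, hδ, hδ2⟩ : ∃ d : ℝ, 0 < d ∧ 2 - m.epsSq * T ^ 2 = d ^ 2 :=
    ⟨_, Real.sqrt_pos.2 hT2, (Real.sq_sqrt hT2.le).symm⟩
  have hsqrt2 : √2 ^ 2 = (2 : ℝ) := Real.sq_sqrt (by norm_num)
  have f1 : √((2 * T ^ 2 / (1 + m.epsSq * T ^ 2)) ^ 3 *
      (2 * (2 - m.epsSq * T ^ 2) / (1 + m.epsSq * T ^ 2))) =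
      4 * T ^ 3 * δ / (1 + m.epsSq * T ^ 2) ^ 2 := by
    rw [hδ2, ← Real.sqrt_sq (show 0 ≤ 4 * T ^ 3 * δ / (1 + m.epsSq * T ^ 2) ^ 2 by positivity)]
    congr 1
    field_simp
    ring
  rw [hd2, Real.sqrt_sq hd.le, f1]
  have hE : m.epsSq * T ^ 2 = 2 - δ ^ 2 := by linarith
  have g0 : 2 - m.epsSq * (√2 * T * q / d) ^ 2 = (√2 * δ / d) ^ 2 := by
    rw [div_pow, mul_pow, mul_pow, hsqrt2, div_pow, mul_pow, hsqrt2]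
    field_simp
    linear_combination -hd2 + hδ2
  have g1 : 3 - m.epsSq * (√2 * T * q / d) ^ 2 =
      (3 * δ ^ 2 + m.epsSq * T ^ 2 * q ^ 2) / d ^ 2 := by
    rw [div_pow, mul_pow, mul_pow, hsqrt2]
    field_simp
    linear_combination -3 * hd2 + 3 * hδ2
  have g2 : 1 + m.epsSq * (√2 * T * q / d * s) ^ 2 =
      (d ^ 2 + 2 * (m.epsSq * T ^ 2) * q ^ 2 * s ^ 2) / d ^ 2 := by
    rw [mul_pow, div_pow, mul_pow, mul_pow, hsqrt2]
    field_simp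
  have g3 : 36 * (2 * (2 - m.epsSq * T ^ 2) / (1 + m.epsSq * T ^ 2)) +
      12 * (2 * (m.epsSq * T ^ 2) / (1 + m.epsSq * T ^ 2)) * q ^ 2 =
      24 * (3 * δ ^ 2 + m.epsSq * T ^ 2 * q ^ 2) / (1 + m.epsSq * T ^ 2) := by
    rw [hδ2]; field_simp; ring
  have g4 : 36 * (2 * (2 - m.epsSq * T ^ 2) / (1 + m.epsSq * T ^ 2)) +
      12 * (2 * (m.epsSq * T ^ 2) / (1 + m.epsSq * T ^ 2)) * q ^ 2 * (3 + 6 * s ^ 2) =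
      72 * (d ^ 2 + 2 * (m.epsSq * T ^ 2) * q ^ 2 * s ^ 2) / (1 + m.epsSq * T ^ 2) := by
    rw [← hd2]; field_simp; ring
  have p1 : 0 < 3 * δ ^ 2 + m.epsSq * T ^ 2 * q ^ 2 := by
    have h0 : 0 < δ ^ 2 := by positivity
    have : 3 * δ ^ 2 + m.epsSq * T ^ 2 * q ^ 2 = 2 * δ ^ 2 + d ^ 2 := by
      rw [← hd2, ← hδ2]; ring
    rw [this]; positivity
  have p2 : 0 < d ^ 2 + 2 * (m.epsSq * T ^ 2) * q ^ 2 * s ^ 2 := by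
    rw [← hd2]
    exact denominator_pos hT1 hT2 hq hs
  rw [g0, Real.sqrt_sq (by positivity), g1, g2, g3, g4, hδ2]
  exact density_identity r T q hT1 p2 p1 hd hδ

/-- The volume formula, for points whose inner product is expressed by the half-edge tangent. -/
lemma IsEquiangular.riemannianVolume_eq_integral (hr : 0 < r) (hT : 0 < T)
    (hT1 : 0 < 1 + m.epsSq * T ^ 2) (hT2 : 0 < 2 - m.epsSq * T ^ 2) {P : Fin 4 → Fin 4 → ℝ}
    (h : m.IsEquiangular r ((1 - m.epsSq * T ^ 2) / (1 + m.epsSq * T ^ 2)) P) :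
    m.riemannianVolume r (m.tetrahedron r P) =
      ENNReal.ofReal (12 * r ^ 3 * ∫ t in (0 : ℝ)..T, m.volumeIntegrand t) := by
  have e1 : 1 - (1 - m.epsSq * T ^ 2) / (1 + m.epsSq * T ^ 2) =
      2 * (m.epsSq * T ^ 2) / (1 + m.epsSq * T ^ 2) := by field_simp; ring
  have e2 : 1 + 3 * ((1 - m.epsSq * T ^ 2) / (1 + m.epsSq * T ^ 2)) =
      2 * (2 - m.epsSq * T ^ 2) / (1 + m.epsSq * T ^ 2) := by field_simp; ring
  have e3 : m.epsSq * (2 * (m.epsSq * T ^ 2) / (1 + m.epsSq * T ^ 2)) =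
      2 * T ^ 2 / (1 + m.epsSq * T ^ 2) := by
    linear_combination (2 * T ^ 2 / (1 + m.epsSq * T ^ 2)) * m.epsSq_mul_self
  have h1 : 0 < m.epsSq * (1 - (1 - m.epsSq * T ^ 2) / (1 + m.epsSq * T ^ 2)) := by
    rw [e1, e3]; positivity
  have h2 : 0 < 1 + 3 * ((1 - m.epsSq * T ^ 2) / (1 + m.epsSq * T ^ 2)) := by
    rw [e2]; positivity
  rw [h.riemannianVolume_eq hr h1 h2, volume_equiangular_eq_lintegral h2, e1, e2, e3,
    ENNReal.ofReal_mul (p := 12 * r ^ 3) (by positivity), intervalIntegral.integral_of_le hT.le,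
    ← integral_Icc_eq_integral_Ioc, ofReal_integral_eq_lintegral_ofReal
      ((continuousOn_volumeIntegrand hT1 hT2).integrableOn_compact isCompact_Icc)
      (ae_restrict_of_forall_mem measurableSet_Icc fun t ht => volumeIntegrand_nonneg hT1 hT2 ht),
    setLIntegral_congr_fun measurableSet_Icc fun t ht => ofReal_volumeIntegrand hT1 hT2 ht,
    lintegral_substitution hT hT2, ← mul_assoc, ← ENNReal.ofReal_mul (by positivity),
    ← lintegral_const_mul' _ _ ENNReal.ofReal_ne_top,
    ← lintegral_const_mul' _ _ ENNReal.ofReal_ne_top]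
  refine setLIntegral_congr_fun measurableSet_Icc fun q hq => ?_
  have hD := radicand_pos hT2 hq
  rw [← mul_assoc (ENNReal.ofReal (12 * r ^ 3)), ← ENNReal.ofReal_mul (by positivity),
    ← lintegral_const_mul' _ _ ENNReal.ofReal_ne_top,
    ← lintegral_const_mul' _ _ ENNReal.ofReal_ne_top]
  have hq0 := hq.1
  refine setLIntegral_congr_fun measurableSet_Icc fun s hs => ?_
  rw [← ENNReal.ofReal_mul (by positivity), ← ENNReal.ofReal_mul (by positivity)]
  congr 1
  exact (density_substitution hT hT1 hT2 hq hs).symm ▸ by ring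

end ModelSpace

/-! ### Klein images, the centred tetrahedron and the complex formula -/

lemma coneHull_add {P : Fin 4 → Fin 4 → ℝ} {X Y : Fin 4 → ℝ} (hX : X ∈ coneHull P)
    (hY : Y ∈ coneHull P) : X + Y ∈ coneHull P := by
  obtain ⟨w, hw, rfl⟩ := hX
  obtain ⟨z, hz, rfl⟩ := hY
  exact ⟨w + z, fun i => add_nonneg (hw i) (hz i), by
    simp only [Pi.add_apply, add_smul, Finset.sum_add_distrib]⟩

/-- A cone over points of an affine hyperplane meets that hyperplane in their convex hull. -/
lemma setOf_affinePoint_mem_coneHull {r : ℝ} (hr : r ≠ 0) {v : Fin 4 → Fin 3 → ℝ} {k : ℝ} (hk : 0 < k)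
    {P : Fin 4 → Fin 4 → ℝ} (hP : ∀ i, P i = k • affinePoint r (v i)) :
    {x | affinePoint r x ∈ coneHull P} = convexHull ℝ (Set.range v) := by
  refine Set.Subset.antisymm ?_ (convexHull_min ?_ ?_)
  · rintro x ⟨w, hw, hx⟩
    have h : ∀ j, affinePoint r x j = ∑ i, (w i * k) * affinePoint r (v i) j := by
      intro j
      rw [hx, Finset.sum_apply]
      refine Finset.sum_congr rfl fun i _ => ?_
      rw [hP]; simp [mul_assoc]
    refine mem_convexHull_of_exists_fintype (fun i => w i * k) v
      (fun i => mul_nonneg (hw i) hk.le) ?_ (fun i => Set.mem_range_self i) ?_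
    -- Comparing last coordinates, all equal to r ≠ 0, shows that the weights sum to 1.
    · have h3 := h 3
      simp only [affinePoint, Matrix.cons_val, ← Finset.sum_mul] at h3
      rw [← Finset.sum_mul]
      exact mul_right_cancel₀ hr (by rw [one_mul]; exact h3.symm)
    · funext j
      rw [Finset.sum_apply]
      fin_cases j
      · exact (h 0).symm
      · exact (h 1).symm
      · exact (h 2).symm
  · rintro _ ⟨i, rfl⟩
    rw [Set.mem_ofPred_eq, ← coneHull_smul_iff hk, ← hP]
    exact ⟨Pi.single i 1, fun j => by by_cases h : j = i <;> simp [h],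
      by simp [Pi.single_apply]⟩
  · intro x hx y hy a b ha hb hab
    have e : affinePoint r (a • x + b • y) = a • affinePoint r x + b • affinePoint r y := by
      ext i
      fin_cases i <;> simp [affinePoint]
      rw [← add_mul, hab, one_mul]
    rw [Set.mem_ofPred_eq, e]
    exact coneHull_add (coneHull_smul hx ha) (coneHull_smul hy hb)

namespace ModelSpace

variable {m : ModelSpace} {r c T : ℝ} {P : Fin 4 → Fin 4 → ℝ}

lemma IsEquiangular.kleinInv_mem (hr : 0 < r) (h : m.IsEquiangular r c P) (h2 : 0 < 1 + 3 * c)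
    {s : ℝ} (hs : s ^ 2 = 1) {x : Fin 3 → ℝ} (hx : s • affinePoint r x ∈ coneHull P) :
    0 < m.kleinForm r x ∧ m.kleinInv r s x ∈ m.tetrahedron r P := by
  have : x ∈ {x | x ∈ m.kleinDomain r ∧ m.kleinInv r s x ∈ m.space r ∩ m.tetrahedron r P} := by
    rw [h.chart_set_eq hr h2 hs]; exact hx
  exact ⟨mem_kleinDomain.1 this.1, this.2.2⟩

lemma IsEquiangular.image_klein (hr : 0 < r) (h : m.IsEquiangular r c P) (h2 : 0 < 1 + 3 * c)
    (hT : m.tetrahedron r P ⊆ m.upper r) :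
    klein r '' m.tetrahedron r P = {x | affinePoint r x ∈ coneHull P} := by
  ext x
  constructor
  · rintro ⟨X, hX, rfl⟩
    have h3 : 0 < X 3 := (hT hX).2
    have e : affinePoint r (klein r X) = (r / X 3) • X := by
      ext i
      fin_cases i <;> simp [affinePoint, klein] <;> field_simp
    rw [Set.mem_ofPred_eq, e, coneHull_smul_iff (by positivity)]
    exact hX.2
  · intro hx
    obtain ⟨hq, hm⟩ := h.kleinInv_mem hr h2 (s := 1) (by norm_num) (by rwa [one_smul])
    refine ⟨_, hm, ?_⟩
    have := (Real.sqrt_pos.2 hq).ne'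
    rw [kleinInv_eq]
    ext i
    fin_cases i <;> simp [affinePoint, klein] <;> field_simp

/-- A tetrahedron inside the upper part does not meet the antipodal chart, so only s = 1
contributes. The denominators r² + η|x|² and ηr² + |x|² differ by the factor η, which squaring
removes. -/
lemma IsEquiangular.riemannianVolume_eq_klein (hr : 0 < r) (h : m.IsEquiangular r c P)
    (h1 : 0 < m.epsSq * (1 - c)) (h2 : 0 < 1 + 3 * c)
    (hT : m.tetrahedron r P ⊆ m.upper r) :
    m.riemannianVolume r (m.tetrahedron r P) = ∫⁻ x in klein r '' m.tetrahedron r P,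
      ENNReal.ofReal (r ^ 4 / (m.epsSq * r ^ 2 + ∑ i, x i ^ 2) ^ 2) := by
  have hempty : {x : Fin 3 → ℝ | (-1 : ℝ) • affinePoint r x ∈ coneHull P} = ∅ := by
    refine Set.eq_empty_of_forall_notMem fun x hx => ?_
    obtain ⟨hq, hm⟩ := h.kleinInv_mem hr h2 (by norm_num) hx
    have h3 := (hT hm).2
    have h4 : 0 < r / √(m.kleinForm r x) := div_pos hr (Real.sqrt_pos.2 hq)
    rw [kleinInv_eq] at h3
    simp [affinePoint] at h3
    nlinarith
  rw [riemannianVolume, h.chartVolume_eq hr h1 h2 (by norm_num),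
    h.chartVolume_eq hr h1 h2 (by norm_num), hempty, h.image_klein hr h2 hT]
  simp only [one_smul, Measure.restrict_empty, lintegral_zero_measure, add_zero]
  refine lintegral_congr fun x => ?_
  congr 2
  rw [kleinForm, Fin.sum_univ_three]
  rcases m.epsSq_eq_or with h | h <;> rw [h] <;> ring

/-- The vertices of the Euclidean regular tetrahedron with edge `b`. -/
noncomputable def regularVertices (b : ℝ) : Fin 4 → Fin 3 → ℝ :=
  ![![b / 2, -(√3 * b / 6), -(√6 * b / 12)], ![-(b / 2), -(√3 * b / 6), -(√6 * b / 12)],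
    ![0, √3 * b / 3, -(√6 * b / 12)], ![0, 0, √6 * b / 4]]

lemma euclideanTetrahedron_eq (b : ℝ) :
    euclideanTetrahedron b = convexHull ℝ (Set.range (regularVertices b)) := by
  rw [euclideanTetrahedron]
  congr 1
  simp only [regularVertices, Matrix.range_cons, Matrix.range_empty, Set.union_empty,
    Set.singleton_union]

lemma form_regularVertices (m : ModelSpace) (r b : ℝ) (i j : Fin 4) :
    m.form (affinePoint r (regularVertices b i)) (affinePoint r (regularVertices b j)) =
      m.epsSq * r ^ 2 + (if i = j then 3 * b ^ 2 / 8 else -(b ^ 2 / 8)) := by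
  have h3 : √3 ^ 2 = (3 : ℝ) := Real.sq_sqrt (by norm_num)
  have h6 : √6 ^ 2 = (6 : ℝ) := Real.sq_sqrt (by norm_num)
  fin_cases i <;> fin_cases j <;> simp [form, affinePoint, regularVertices] <;> ring_nf <;>
    (try rw [h3]) <;> (try rw [h6]) <;> ring

lemma kleinEdge_eq (m : ModelSpace) (r a : ℝ) : m.kleinEdge r a =
    2 * r * m.tn (a / (2 * r)) / √(1 - m.epsSq * m.tn (a / (2 * r)) ^ 2 / 2) := by
  cases m <;> simp [kleinEdge, tn, epsSq, neg_div]

/-- The regular tetrahedron centred at the point with Klein coordinates `0`. -/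
lemma exists_isEquiangular_centred (hr : 0 < r) (hT : 0 < T) (hT1 : 0 < 1 + m.epsSq * T ^ 2)
    (hT2 : 0 < 2 - m.epsSq * T ^ 2) :
    ∃ P, m.IsEquiangular r ((1 - m.epsSq * T ^ 2) / (1 + m.epsSq * T ^ 2)) P ∧
      m.tetrahedron r P ⊆ m.upper r ∧ {x | affinePoint r x ∈ coneHull P} =
        euclideanTetrahedron (2 * r * T / √(1 - m.epsSq * T ^ 2 / 2)) := by
  set b := 2 * r * T / √(1 - m.epsSq * T ^ 2 / 2) with hb
  have hb2 : b ^ 2 = 8 * r ^ 2 * T ^ 2 / (2 - m.epsSq * T ^ 2) := by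
    have : 0 < 1 - m.epsSq * T ^ 2 / 2 := by linarith
    rw [hb, div_pow, Real.sq_sqrt this.le,
      show 1 - m.epsSq * T ^ 2 / 2 = (2 - m.epsSq * T ^ 2) / 2 by ring]
    field_simp
    ring
  -- The value r² + η · 3b²/8 of `kleinForm` at every vertex, 3b²/8 being the squared circumradius;
  -- r/√q is the factor that projects the vertices to the space.
  set q := 2 * r ^ 2 * (1 + m.epsSq * T ^ 2) / (2 - m.epsSq * T ^ 2) with hq
  have hq0 : 0 < q := by positivity
  have hsq := Real.sqrt_pos.2 hq0
  have hη := m.epsSq_mul_self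
  have hform : ∀ i j, m.form ((r / √q) • affinePoint r (regularVertices b i))
      ((r / √q) • affinePoint r (regularVertices b j)) = m.epsSq * r ^ 2 *
        (if i = j then 1 else (1 - m.epsSq * T ^ 2) / (1 + m.epsSq * T ^ 2)) := by
    intro i j
    have : m.form ((r / √q) • affinePoint r (regularVertices b i))
        ((r / √q) • affinePoint r (regularVertices b j)) = (r / √q) ^ 2 *
        m.form (affinePoint r (regularVertices b i)) (affinePoint r (regularVertices b j)) := by
      simp only [form, Pi.smul_apply, smul_eq_mul]; ring
    rw [this, form_regularVertices, div_pow, Real.sq_sqrt hq0.le, hb2, hq]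
    split_ifs
    · field_simp
      linear_combination (-3 * T ^ 2) * hη
    · field_simp
      linear_combination (T ^ 2) * hη
  have hP3 : ∀ i, ((r / √q) • affinePoint r (regularVertices b i)) 3 = r / √q * r := by
    intro i; simp [affinePoint]
  refine ⟨fun i => (r / √q) • affinePoint r (regularVertices b i),
    ⟨fun i => ⟨?_, fun _ => ?_⟩, fun i j hij => ?_⟩, ?_, ?_⟩
  · rw [hform]; simp
  · rw [hP3]; positivity
  · rw [hform, if_neg hij]
  · rintro X ⟨hX, w, hw, hXw⟩
    refine ⟨hX, ?_⟩
    have hX3 : X 3 = (∑ i, w i) * (r / √q * r) := by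
      rw [hXw, Finset.sum_apply, Finset.sum_mul]
      refine Finset.sum_congr rfl fun i _ => ?_
      exact congrArg (w i * ·) (hP3 i)
    rw [hX3]
    refine mul_pos (lt_of_le_of_ne (Finset.sum_nonneg fun i _ => hw i) fun h0 => ?_)
      (by positivity)
    -- If the weights summed to zero, X would be the origin, which does not lie on the hypersurface.
    rw [eq_comm, Finset.sum_eq_zero_iff_of_nonneg fun i _ => hw i] at h0
    have hX0 : X = 0 := by
      rw [hXw]
      exact Finset.sum_eq_zero fun i hi => by rw [h0 i hi, zero_smul]
    have h1 := hX.1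
    rw [hX0] at h1
    simp [form] at h1
    rcases h1 with h1 | h1
    · rw [h1] at hη; simp at hη
    · exact hr.ne' h1
  · rw [euclideanTetrahedron_eq]
    exact setOf_affinePoint_mem_coneHull hr.ne' (div_pos hr hsq) fun i => rfl

/-- The segment integral is real up to the unit `ε³`. -/
lemma segmentIntegral_eq (m : ModelSpace) {x : ℝ} (hT : 0 < m.tn x)
    (hT1 : 0 < 1 + m.epsSq * m.tn x ^ 2) (hT2 : 0 < 2 - m.epsSq * m.tn x ^ 2) :
    m.eps ^ 3 * segmentIntegral
      (fun t => t * Complex.arctan t / ((3 - t ^ 2) * (2 - t ^ 2) ^ (1 / 2 : ℂ)))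
      (Complex.tan ((x : ℂ) / m.eps)) = ((∫ t in (0 : ℝ)..m.tn x, m.volumeIntegrand t : ℝ) : ℂ) := by
  -- Here κ = 1/ε, that is 1 or -i. The path element, the factor t and the arctangent each
  -- contribute one κ, and κ³ = κη is cancelled by ε³.
  obtain ⟨κ, hκ, hκ2, htan, harctan⟩ : ∃ κ : ℂ, m.eps ^ 3 * κ * m.epsSq = 1 ∧
      κ ^ 2 = m.epsSq ∧ Complex.tan ((x : ℂ) / m.eps) = κ * m.tn x ∧
      ∀ t ∈ Set.Icc 0 (m.tn x), Complex.arctan (κ * t) = κ * m.atn t := by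
    cases m
    · exact ⟨1, by simp [eps, epsSq], by simp [epsSq], by simp [eps, tn],
        fun t _ => by simp [atn]⟩
    · refine ⟨-Complex.I, ?_, ?_, ?_, fun t ht => ?_⟩
      · simp [eps, epsSq, pow_succ]
      · simp [epsSq]
      · have : (x : ℂ) / Complex.I = (-x : ℝ) * Complex.I := by
          rw [Complex.div_I]; push_cast; ring
        simp only [eps, tn]
        rw [this, Complex.tan_mul_I]
        push_cast
        rw [Complex.tanh_neg]
        ring
      · have hb := bounds_of_le hT1 hT2 ht
        simp only [epsSq, tn, atn] at *
        have hI : -Complex.I * (t : ℂ) * Complex.I = t := by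
          linear_combination -(t : ℂ) * Complex.I_mul_I
        have ht1 : t < 1 := by nlinarith [ht.1, hb.1]
        rw [Complex.arctan, hI, Real.artanh_eq_half_log ⟨by linarith [ht.1], ht1.le⟩]
        have : (0 : ℝ) ≤ (1 + t) / (1 - t) := div_nonneg (by linarith [ht.1]) (by linarith)
        push_cast [Complex.ofReal_log this]
        ring
  rw [segmentIntegral, htan]
  have hpt : ∀ s ∈ Set.uIcc (0 : ℝ) 1, (κ * m.tn x * ((s * (κ * m.tn x)) *
      Complex.arctan (s * (κ * m.tn x)) / ((3 - (s * (κ * m.tn x)) ^ 2) *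
        (2 - (s * (κ * m.tn x)) ^ 2) ^ (1 / 2 : ℂ))) : ℂ) =
      κ * m.epsSq * ((m.tn x * m.volumeIntegrand (m.tn x * s) : ℝ) : ℂ) := by
    intro s hs
    rw [Set.uIcc_of_le zero_le_one] at hs
    have ht : m.tn x * s ∈ Set.Icc 0 (m.tn x) :=
      ⟨mul_nonneg hT.le hs.1, mul_le_of_le_one_right hT.le hs.2⟩
    have e : (s : ℂ) * (κ * m.tn x) = κ * ((m.tn x * s : ℝ) : ℂ) := by push_cast; ring
    have hb := (bounds_of_le hT1 hT2 ht).2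
    rw [e, harctan _ ht]
    have e2 : (κ * ((m.tn x * s : ℝ) : ℂ)) ^ 2 = ((m.epsSq * (m.tn x * s) ^ 2 : ℝ) : ℂ) := by
      rw [mul_pow, hκ2]; push_cast; ring
    rw [e2, volumeIntegrand, Real.sqrt_eq_rpow]
    -- Along the segment the radicand is a positive real, so the principal complex power is the real
    -- square root.
    have e3 : (2 - ((m.epsSq * (m.tn x * s) ^ 2 : ℝ) : ℂ)) ^ (1 / 2 : ℂ) =
        (((2 - m.epsSq * (m.tn x * s) ^ 2) ^ (1 / 2 : ℝ) : ℝ) : ℂ) := by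
      rw [Complex.ofReal_cpow hb.le]; push_cast; rfl
    rw [e3]
    push_cast
    rw [← hκ2]
    ring
  rw [intervalIntegral.integral_congr hpt, intervalIntegral.integral_const_mul,
    intervalIntegral.integral_ofReal, intervalIntegral.integral_const_mul,
    intervalIntegral.mul_integral_comp_mul_left, mul_zero, mul_one]
  linear_combination ((∫ t in (0 : ℝ)..m.tn x, m.volumeIntegrand t : ℝ) : ℂ) * hκ

end ModelSpace

theorem mainTheorem2 (m : ModelSpace) (r a : ℝ) (hr : 0 < r) (ha : 0 < a)
    (hmax : m = ModelSpace.sphere → a < 2 * Real.arctan (√2) * r) :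
    (∀ P : Fin 4 → Fin 4 → ℝ, m.IsRegularTetrahedron r a P →
      -- the unified formula, with `ε = 1` or `ε = i`
      m.riemannianVolume r (m.tetrahedron r P) ≠ ⊤ ∧
      ((m.riemannianVolume r (m.tetrahedron r P)).toReal : ℂ) =
        12 * m.eps ^ 3 * (r : ℂ) ^ 3 *
          segmentIntegral
            (fun t => t * Complex.arctan t / ((3 - t ^ 2) * (2 - t ^ 2) ^ (1 / 2 : ℂ)))
            (Complex.tan ((a : ℂ) / (2 * m.eps * (r : ℂ)))) ∧
      -- the spherical case
      (m = ModelSpace.sphere →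
        m.riemannianVolume r (m.tetrahedron r P) = ENNReal.ofReal (12 * r ^ 3 *
          ∫ t in (0 : ℝ)..Real.tan (a / (2 * r)),
            t * Real.arctan t / ((3 - t ^ 2) * √(2 - t ^ 2)))) ∧
      -- the hyperbolic case
      (m = ModelSpace.hyperbolic →
        m.riemannianVolume r (m.tetrahedron r P) = ENNReal.ofReal (12 * r ^ 3 *
          ∫ t in (0 : ℝ)..Real.tanh (a / (2 * r)),
            t * Real.artanh t / ((3 + t ^ 2) * √(2 + t ^ 2)))) ∧
      -- the volume as an integral over the image in Klein coordinates
      (m.tetrahedron r P ⊆ m.upper r →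
        m.riemannianVolume r (m.tetrahedron r P) =
          ∫⁻ x in ModelSpace.klein r '' m.tetrahedron r P,
            ENNReal.ofReal (r ^ 4 / (m.epsSq * r ^ 2 + ∑ i, x i ^ 2) ^ 2))) ∧
    -- such tetrahedra exist, one of them with a Euclidean regular tetrahedron as its Klein image
    ∃ P : Fin 4 → Fin 4 → ℝ, m.IsRegularTetrahedron r a P ∧
      m.tetrahedron r P ⊆ m.upper r ∧
      ModelSpace.klein r '' m.tetrahedron r P = euclideanTetrahedron (m.kleinEdge r a) := by
  obtain ⟨hT, hT1, hT2, hatn⟩ := m.tn_bounds hr ha hmax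
  have hc1 : 0 < m.epsSq * (1 - (1 - m.epsSq * m.tn (a / (2 * r)) ^ 2) /
      (1 + m.epsSq * m.tn (a / (2 * r)) ^ 2)) := by
    have : m.epsSq * (1 - (1 - m.epsSq * m.tn (a / (2 * r)) ^ 2) /
        (1 + m.epsSq * m.tn (a / (2 * r)) ^ 2)) =
        2 * m.tn (a / (2 * r)) ^ 2 / (1 + m.epsSq * m.tn (a / (2 * r)) ^ 2) := by
      field_simp
      linear_combination (2 * m.tn (a / (2 * r)) ^ 2) * m.epsSq_mul_self
    rw [this]; positivity
  have hc2 : 0 < 1 + 3 * ((1 - m.epsSq * m.tn (a / (2 * r)) ^ 2) /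
      (1 + m.epsSq * m.tn (a / (2 * r)) ^ 2)) := by
    have : 1 + 3 * ((1 - m.epsSq * m.tn (a / (2 * r)) ^ 2) /
        (1 + m.epsSq * m.tn (a / (2 * r)) ^ 2)) =
        2 * (2 - m.epsSq * m.tn (a / (2 * r)) ^ 2) /
          (1 + m.epsSq * m.tn (a / (2 * r)) ^ 2) := by
      field_simp; ring
    rw [this]; positivity
  constructor
  · rintro P ⟨hP, hPa⟩
    have h : m.IsEquiangular r ((1 - m.epsSq * m.tn (a / (2 * r)) ^ 2) /
        (1 + m.epsSq * m.tn (a / (2 * r)) ^ 2)) P :=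
      ⟨hP, fun i j hij => m.form_eq_of_arcLength hr ha (hP i) (hP j) (hPa i j hij)⟩
    have hV := h.riemannianVolume_eq_integral hr hT hT1 hT2
    refine ⟨by rw [hV]; exact ENNReal.ofReal_ne_top, ?_, ?_, ?_,
      h.riemannianVolume_eq_klein hr hc1 hc2⟩
    · have hnn : 0 ≤ ∫ t in (0 : ℝ)..m.tn (a / (2 * r)), m.volumeIntegrand t :=
        intervalIntegral.integral_nonneg hT.le fun t ht =>
          ModelSpace.volumeIntegrand_nonneg hT1 hT2 ht
      have hs := m.segmentIntegral_eq hT hT1 hT2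
      have e : (a : ℂ) / (2 * m.eps * r) = ((a / (2 * r) : ℝ) : ℂ) / m.eps := by
        push_cast; rw [div_div]; ring_nf
      rw [hV, ENNReal.toReal_ofReal (by positivity), e]
      push_cast
      push_cast at hs
      rw [← hs]
      ring
    · rintro rfl
      rw [hV]
      simp only [ModelSpace.volumeIntegrand, ModelSpace.tn, ModelSpace.atn, ModelSpace.epsSq,
        one_mul]
    · rintro rfl
      rw [hV]
      simp only [ModelSpace.volumeIntegrand, ModelSpace.tn, ModelSpace.atn, ModelSpace.epsSq,
        neg_mul, one_mul, sub_neg_eq_add]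
  · obtain ⟨P, h, hup, himage⟩ := ModelSpace.exists_isEquiangular_centred hr hT hT1 hT2
    refine ⟨P, ⟨h.mem, fun i j hij => ?_⟩, hup, ?_⟩
    · rw [m.arcLength_eq hr hT.le hT1 rfl (h.mem i).1 (h.mem j).1 (h.form_eq i j hij), hatn]
      field_simp
    · rw [h.image_klein hr hc2 hup, himage, m.kleinEdge_eq]
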